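/- For a function $f\colon G\to\mathbb{C}$ on a finite abelian group and $s\ge 1$, let $\partial_h f(n)=f(n)\overline{f(n-h)}$ and let the Gowers norm $\|f\|_{U^s}\ge 0$ be given by $\|f\|_{U^s}^{2^s}=\mathbb{E}_{n,h_1,\dots,h_s\in G}\,\partial_{h_1}\cdots\partial_{h_s}f(n)$. For $A\subseteq\mathbb{Z}/N\mathbb{Z}$ let $\Lambda_k(1_A)=\mathbb{E}_{n,d\in\mathbb{Z}/N\mathbb{Z}}\,1_A(n)1_A(n+d)\cdots 1_A(n+(k-1)d)$. For an integer $k\ge 4$ and $0<\alpha<1$, let $\rho_k(\alpha)$ be the largest real number $\rho$ such that for every $\epsilon>0$ there exist $\eta>0$ and $N_0$ such that, whenever $N\ge N_0$ and $A\subseteq\mathbb{Z}/N\mathbb{Z}$ satisfies $\|1_A-\alpha\|_{U^{k-2}}\le\eta$, one has $\Lambda_k(1_A)\ge\rho-\epsilon$. For even $k$, a symmetrically colored $k$-AP in a coloring of $[N]=\{1,\dots,N\}$ is a progression $n,n+d,\dots,n+(k-1)d$ in $[N]$ with $d\ne 0$ such that $n+(i-1)d$ and $n+(k-i)d$ have the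 same color for all $i=1,\dots,k/2$. **Theorem.** Let $k\ge 4$ be even. Suppose that for every $N\ge 1$ there is a coloring of $[N]$ with at most $N^{g(N)}$ colors and no symmetrically colored $k$-AP, where $g(N)\to 0$ as $N\to\infty$. Then for every $C>0$ there is $\alpha_0\in(0,1]$ such that for all $0<\alpha<\alpha_0$ the largest number $\rho_k(\alpha)$ exists and satisfies $\rho_k(\alpha)<\alpha^C$. -/

import Mathlib

open scoped BigOperators

namespace UniformAP

/-- The multiplicative derivative `∂_h f(n) = f(n) * conj (f(n - h))`. -/
noncomputable def mulDeriv {G : Type*} [AddCommGroup G] (h : G) (f : G → ℂ) : G → ℂ :=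
  fun n => f n * starRingEnd ℂ (f (n - h))

/-- The iterated derivative `∂_{h_1} ∂_{h_2} ⋯ ∂_{h_s} f`. -/
noncomputable def iterMulDeriv {G : Type*} [AddCommGroup G] :
    (s : ℕ) → (Fin s → G) → (G → ℂ) → G → ℂ
  | 0, _, f => f
  | s + 1, h, f => mulDeriv (h 0) (iterMulDeriv s (Fin.tail h) f)

/-- The average `𝔼_{n, h_1, …, h_s} ∂_{h_1} ⋯ ∂_{h_s} f(n)` over a finite abelian group. -/
noncomputable def gowersAverage {G : Type*} [AddCommGroup G] [Fintype G]
    (s : ℕ) (f : G → ℂ) : ℂ :=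
  𝔼 n : G, 𝔼 h : Fin s → G, iterMulDeriv s h f n

/-- For `s ≥ 1` the Gowers average is a nonnegative real number. -/
theorem gowersAverage_nonneg {G : Type*} [AddCommGroup G] [Fintype G]
    {s : ℕ} (hs : 1 ≤ s) (f : G → ℂ) : ∃ x : ℝ, 0 ≤ x ∧ gowersAverage s f = (x : ℂ) := by
  obtain ⟨s, rfl⟩ : ∃ t, s = t + 1 := ⟨s - 1, by omega⟩
  have h1 : gowersAverage (s + 1) f =
      𝔼 t : Fin s → G, (𝔼 n : G, iterMulDeriv s t f n) *
        starRingEnd ℂ (𝔼 n : G, iterMulDeriv s t f n) := by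
    unfold gowersAverage
    rw [Finset.expect_comm]
    rw [← Fintype.expect_equiv (Fin.consEquiv (fun _ => G))
      (fun p : G × (Fin s → G) => 𝔼 n : G, iterMulDeriv (s + 1) (Fin.cons p.1 p.2) f n) _
      (fun p => rfl)]
    rw [← Finset.univ_product_univ, Finset.expect_product, Finset.expect_comm]
    refine Finset.expect_congr rfl fun t _ => ?_
    rw [Finset.expect_comm, map_expect, Finset.expect_mul]
    refine Finset.expect_congr rfl fun n _ => ?_
    simp only [iterMulDeriv, mulDeriv, Fin.cons_zero, Fin.tail_cons]
    rw [← Finset.mul_expect]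
    congr 1
    exact Fintype.expect_equiv (Equiv.subLeft n) _ _ fun h => rfl
  rw [h1]
  refine ⟨𝔼 t : Fin s → G, Complex.normSq (𝔼 n : G, iterMulDeriv s t f n),
    Finset.expect_nonneg fun t _ => Complex.normSq_nonneg _, ?_⟩
  simp only [Complex.mul_conj]
  exact (map_expect Complex.ofRealHom _ _).symm

/-- The Gowers uniformity norm `‖f‖_{U^s}` on a finite abelian group, for `s ≥ 1`: the nonnegative
real number whose `2^s`-th power is `gowersAverage s f`. -/
noncomputable def gowersNorm {G : Type*} [AddCommGroup G] [Fintype G]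
    (s : ℕ) (f : G → ℂ) : ℝ :=
  ‖gowersAverage s f‖ ^ ((1 : ℝ) / 2 ^ s)

/-- For `s ≥ 1`, `‖f‖_{U^s} ^ (2^s)` is the Gowers average. -/
theorem gowersNorm_pow {G : Type*} [AddCommGroup G] [Fintype G]
    {s : ℕ} (hs : 1 ≤ s) (f : G → ℂ) :
    ((gowersNorm s f ^ 2 ^ s : ℝ) : ℂ) = gowersAverage s f := by
  have h1 : gowersNorm s f ^ 2 ^ s = ‖gowersAverage s f‖ := by
    rw [gowersNorm, one_div, ← Real.rpow_natCast, ← Real.rpow_mul (norm_nonneg _)]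
    simp
  rw [h1]
  obtain ⟨x, hx, hfx⟩ := gowersAverage_nonneg hs f
  rw [hfx, Complex.norm_real, Real.norm_of_nonneg hx]

/-- The `k`-AP density `Λ_k(1_A) = 𝔼_{n,d} 1_A(n) 1_A(n+d) ⋯ 1_A(n+(k-1)d)`. -/
noncomputable def apDensity {G : Type*} [AddCommGroup G] [Fintype G]
    (k : ℕ) (A : Set G) : ℝ :=
  𝔼 n : G, 𝔼 d : G, ∏ i ∈ Finset.range k, A.indicator (fun _ => (1 : ℝ)) (n + i • d)

/-- The real numbers `ρ` such that for every `ε > 0` there are `η > 0` and `N₀` such that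
`Λ_k(1_A) ≥ ρ - ε` whenever `N ≥ N₀` and `A ⊆ ℤ/Nℤ` satisfies `‖1_A - α‖_{U^{k-2}} ≤ η`. -/
def apDensityBounds (k : ℕ) (α : ℝ) : Set ℝ :=
  {ρ : ℝ | ∀ ε : ℝ, 0 < ε → ∃ η : ℝ, 0 < η ∧ ∃ N₀ : ℕ, ∀ (N : ℕ) [NeZero N], N₀ ≤ N →
    ∀ A : Set (ZMod N),
      gowersNorm (k - 2) (fun n => A.indicator (fun _ => (1 : ℂ)) n - (α : ℂ)) ≤ η →
        ρ - ε ≤ apDensity k A}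

/-- `ρ_k(α)`: the largest element of `apDensityBounds k α`. -/
noncomputable def rho (k : ℕ) (α : ℝ) : ℝ := sSup (apDensityBounds k α)

/-- The coloring `φ` of `[N] = {1, …, N}` (its values outside `[N]` play no role) contains a
symmetrically colored `k`-AP: a progression `n, n + d, …, n + (k-1)d` in `[N]` with `d ≠ 0` in which
`n + (i-1)d` and `n + (k-i)d` have the same color for all `i = 1, …, k/2`. -/
def HasSymmetricallyColoredAP {κ : Type*} (k N : ℕ) (φ : ℤ → κ) : Prop :=
  ∃ n d : ℤ, d ≠ 0 ∧
    (∀ i ∈ Finset.range k, n + (i : ℤ) * d ∈ Set.Icc (1 : ℤ) (N : ℤ)) ∧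
    ∀ i ∈ Finset.Icc 1 (k / 2), φ (n + ((i : ℤ) - 1) * d) = φ (n + ((k : ℤ) - (i : ℤ)) * d)

end UniformAP

/-! Fix a prime `M` slightly larger than `α⁻¹ ^ C` and a coloring `ψ` of `ZMod M` with very few
colors. For a huge prime `Q`, identify `ZMod (M * Q)` with `ZMod M × ZMod Q` and let `A` consist of
the `(u, v)` for which `v ^ (k - 2)` lies in an interval of length about `α * Q` whose position
depends only on the color `ψ u`.

`A` is uniform whatever the positions are. Expanding the interval in Fourier series, the zero
frequency gives the density `α` up to `1 / Q`, and every other frequency is a function of `u` times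
a polynomial phase of degree exactly `k - 2` in `v`, whose `U^(k-2)` norm is at most a negative
power of `Q`. The coefficients sum to `O(log Q)`, so the error tends to zero
(`norm_gowersAverage_powLevelSet_le`).

`A` has few progressions. The values of `v ^ (k - 2)` along a `k`-AP satisfy the linear relation
with coefficients `(-1)^i * (k-1).choose i`. With the positions coded on a moment curve, this
relation forces the coloring of the projected progression in `ZMod M` to be balanced: the
coefficients in each color class sum to zero (`isBalanced_of_forall_mem_powLevelSet`). If `ψ` admits
no balanced progression with nonzero difference, then every progression in `A` has difference zero
in `ZMod M`, so its density is at most `1 / M < α ^ C`.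

Such a `ψ` comes from the hypothesis (`exists_zmod_coloring_of_coloring`). Refine the given coloring
by a Behrend-type coloring, so that no color occurs three times in a progression. A balanced class
then has exactly two terms, and equality of binomial coefficients makes them symmetric. Thus a
balanced progression is symmetrically colored, and after lifting to the integers it contradicts the
hypothesis. The refinement costs only `M ^ o(1)` colors, which leaves room in `ZMod Q` for intervals
of density `α`. -/

open scoped BigOperators

namespace UniformAP

open Finset

/-! ### Expansions in a base, and balanced colorings of progressions -/

/-- A vanishing expansion in base `b` with digits smaller than `b` in absolute value is trivial. -/
theorem eq_zero_of_sum_mul_pow_eq_zero {b : ℤ} (hb : 0 < b) (D : ℕ) (e : ℕ → ℤ)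
    (he : ∀ j < D, |e j| < b) (h : ∑ j ∈ range D, e j * b ^ j = 0) : ∀ j < D, e j = 0 := by
  induction D generalizing e with
  | zero => intro j hj; omega
  | succ D ih =>
    rw [sum_range_succ'] at h
    have h1 : ∑ j ∈ range D, e (j + 1) * b ^ (j + 1) = b * ∑ j ∈ range D, e (j + 1) * b ^ j := by
      rw [mul_sum]
      exact sum_congr rfl fun j _ => by ring
    rw [h1, pow_zero, mul_one] at h
    have h0 : e 0 = 0 := by
      refine Int.eq_zero_of_abs_lt_dvd (m := b) ⟨-∑ j ∈ range D, e (j + 1) * b ^ j, ?_⟩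
        (he 0 (by omega))
      linarith
    rw [h0, add_zero] at h
    have h2 := ih (fun j => e (j + 1)) (fun j hj => he (j + 1) (by omega))
      ((mul_eq_zero.1 h).resolve_left hb.ne')
    intro j hj
    cases j with
    | zero => exact h0
    | succ j => exact h2 j (by omega)

/-- The coefficient `(-1)^i * (k-1).choose i` of the `i`-th term in the linear relation satisfied by
the values of a polynomial of degree less than `k - 1` along a `k`-term progression. -/
def apCoeff (k i : ℕ) : ℤ := (-1) ^ i * ((k - 1).choose i : ℤ)

/-- A coloring of the `k` terms of a progression is balanced if the coefficients of each color class
sum to zero. -/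
def IsBalanced {κ : Type*} (k : ℕ) (a : ℕ → κ) : Prop :=
  ∀ s : Finset ℕ, s ⊆ range k → (∃ c, ∀ i < k, i ∈ s ↔ a i = c) → ∑ i ∈ s, apCoeff k i = 0

theorem IsBalanced.of_comp {κ κ' : Type*} {k : ℕ} {a : ℕ → κ} {f : κ → κ'}
    (hf : Function.Injective f) (h : IsBalanced k (fun i => f (a i))) : IsBalanced k a := by
  rintro s hs ⟨c, hc⟩
  exact h s hs ⟨f c, fun i hi => by rw [hc i hi, hf.eq_iff]⟩

theorem abs_apCoeff (k i : ℕ) : |apCoeff k i| = ((k - 1).choose i : ℤ) := by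
  simp [apCoeff, abs_mul]

theorem apCoeff_ne_zero {k i : ℕ} (hi : i < k) : apCoeff k i ≠ 0 := by
  have : 0 < (k - 1).choose i := Nat.choose_pos (by omega)
  rw [← abs_pos, abs_apCoeff]
  exact_mod_cast this

theorem sum_abs_apCoeff {k : ℕ} (hk : 1 ≤ k) : ∑ i ∈ range k, |apCoeff k i| = 2 ^ (k - 1) := by
  simp only [abs_apCoeff]
  have := Nat.sum_range_choose (k - 1)
  rw [Nat.sub_add_cancel hk] at this
  exact_mod_cast this

theorem abs_sum_apCoeff_mul_le {k : ℕ} (hk : 1 ≤ k) {x : ℕ → ℤ} {B : ℤ}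
    (hx : ∀ i < k, |x i| ≤ B) : |∑ i ∈ range k, apCoeff k i * x i| ≤ 2 ^ (k - 1) * B := by
  refine (abs_sum_le_sum_abs _ _).trans ?_
  rw [← sum_abs_apCoeff hk, sum_mul]
  refine sum_le_sum fun i hi => ?_
  rw [abs_mul]
  exact mul_le_mul_of_nonneg_left (hx i (mem_range.1 hi)) (abs_nonneg _)

/-- If all low power sums of the colors, weighted by the coefficients, vanish, then the coloring is
balanced. -/
theorem isBalanced_of_sum_pow {k : ℕ} {a : ℕ → ℕ}
    (h : ∀ m < k, ∑ i ∈ range k, apCoeff k i * (a i : ℤ) ^ m = 0) : IsBalanced k a := by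
  rintro s hs ⟨c, hc⟩
  have hpoly : ∀ p : Polynomial ℤ, p.natDegree < k →
      ∑ i ∈ range k, apCoeff k i * p.eval (a i : ℤ) = 0 := by
    intro p hp
    simp only [Polynomial.eval_eq_sum_range' hp, mul_sum]
    rw [sum_comm]
    refine sum_eq_zero fun m hm => ?_
    have := h m (mem_range.1 hm)
    calc _ = p.coeff m * ∑ i ∈ range k, apCoeff k i * (a i : ℤ) ^ m := by
          rw [mul_sum]; exact sum_congr rfl fun i _ => by ring
      _ = 0 := by rw [this, mul_zero]
  rcases s.eq_empty_or_nonempty with rfl | ⟨i₀, hi₀⟩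
  · simp
  have hi₀k := mem_range.1 (hs hi₀)
  have hci₀ := (hc i₀ hi₀k).1 hi₀
  -- The product over all other colors vanishes at each of them but not at `c`, so it isolates the
  -- class of `c`. At most `k` colors occur, hence its degree is below `k`.
  set T := ((range k).image a).erase c with hT
  set p : Polynomial ℤ := ∏ b ∈ T, (Polynomial.X - Polynomial.C (b : ℤ)) with hp
  have hdeg : p.natDegree < k := by
    rw [hp, Polynomial.natDegree_prod_of_monic _ _ fun b _ => Polynomial.monic_X_sub_C _]
    simp only [Polynomial.natDegree_X_sub_C, sum_const, smul_eq_mul, mul_one]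
    have h1 : c ∈ (range k).image a := mem_image.2 ⟨i₀, mem_range.2 hi₀k, hci₀⟩
    have h2 : T.card < ((range k).image a).card := card_erase_lt_of_mem h1
    have h3 := card_image_le (s := range k) (f := a)
    rw [card_range] at h3
    omega
  have h1 := hpoly p hdeg
  have hpc : p.eval (c : ℤ) ≠ 0 := by
    rw [hp, Polynomial.eval_prod]
    refine prod_ne_zero_iff.2 fun b hb => ?_
    have : b ≠ c := (mem_erase.1 hb).1
    simp only [Polynomial.eval_sub, Polynomial.eval_X, Polynomial.eval_C]
    omega
  have h2 : ∑ i ∈ range k, apCoeff k i * p.eval (a i : ℤ) = (∑ i ∈ s, apCoeff k i) * p.eval (c : ℤ) := by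
    rw [sum_mul, ← sum_subset hs]
    · exact sum_congr rfl fun i hi => by rw [(hc i (mem_range.1 (hs hi))).1 hi]
    · intro i hi his
      have hne : a i ≠ c := fun h => his ((hc i (mem_range.1 hi)).2 h)
      rw [hp, Polynomial.eval_prod, prod_eq_zero (i := a i), mul_zero]
      · exact mem_erase.2 ⟨hne, mem_image_of_mem _ hi⟩
      · simp
  rw [h2] at h1
  exact (mul_eq_zero.1 h1).resolve_right hpc

/-- The moment curve encoding of the color `a` as an integer. -/
def momentCode (k r a : ℕ) : ℕ := ∑ m ∈ range k, a ^ m * (2 ^ k * r ^ k) ^ m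

/-- For fixed `k` the codes are polynomially bounded in the number of colors; the exponent `k * k +
k` determines later how few colors are needed. -/
theorem momentCode_le {k r a : ℕ} (ha : a < r) :
    momentCode k r a ≤ k * (2 ^ (k * k) * r ^ (k * k + k)) := by
  unfold momentCode
  have hr : 1 ≤ r := by omega
  calc _ ≤ ∑ m ∈ range k, r ^ k * (2 ^ k * r ^ k) ^ k := by
        refine sum_le_sum fun m hm => Nat.mul_le_mul ?_ ?_
        · exact (Nat.pow_le_pow_left ha.le _).trans
            (Nat.pow_le_pow_right hr (mem_range.1 hm).le)
        · exact Nat.pow_le_pow_right (by positivity) (mem_range.1 hm).le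
    _ = _ := by
        rw [sum_const, card_range, smul_eq_mul]
        ring

/-- The weighted sum of codes is an expansion in base `2 ^ k * r ^ k` whose digits are the weighted
power sums. These are at most `2 ^ (k - 1) * r ^ k` in absolute value, so they all vanish. -/
theorem isBalanced_of_sum_momentCode {k r : ℕ} (hk : 1 ≤ k) {a : ℕ → ℕ} (ha : ∀ i < k, a i < r)
    (h : ∑ i ∈ range k, apCoeff k i * (momentCode k r (a i) : ℤ) = 0) : IsBalanced k a := by
  have hr : 1 ≤ r := by have := ha 0 (by omega); omega
  refine isBalanced_of_sum_pow ?_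
  refine eq_zero_of_sum_mul_pow_eq_zero (b := 2 ^ k * r ^ k) (by positivity) k _ ?_ ?_
  · intro m hm
    refine (abs_sum_apCoeff_mul_le hk (B := (r : ℤ) ^ k) ?_).trans_lt ?_
    · intro i hi
      rw [abs_of_nonneg (by positivity)]
      exact_mod_cast (Nat.pow_le_pow_left (ha i hi).le m).trans (Nat.pow_le_pow_right hr hm.le)
    · have : (2 : ℤ) ^ (k - 1) < 2 ^ k := pow_lt_pow_right₀ (by norm_num) (by omega)
      exact mul_lt_mul_of_pos_right this (by positivity)
  · rw [← h]
    simp only [momentCode, sum_mul]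
    rw [sum_comm]
    refine sum_congr rfl fun i _ => ?_
    push_cast
    rw [mul_sum]
    exact sum_congr rfl fun m _ => by ring

theorem choose_lt_choose_of_lt_half {n i j : ℕ} (hij : i < j) (hj : 2 * j ≤ n) :
    n.choose i < n.choose j := by
  induction j, hij using Nat.le_induction with
  | base =>
    have h1 := Nat.choose_succ_right_eq n i
    have h2 : 0 < n.choose i := Nat.choose_pos (by omega)
    by_contra! h
    have h3 : n.choose (i + 1) * (i + 1) ≤ n.choose i * (i + 1) := Nat.mul_le_mul_right _ h
    rw [h1] at h3
    have := Nat.le_of_mul_le_mul_left h3 h2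
    omega
  | succ j hij ih =>
    have h0 := ih (by omega)
    refine h0.trans_le (Nat.choose_le_succ_of_lt_half_left (by omega))

/-- Binomial coefficients increase strictly up to the middle, so reflecting both indices into the
first half determines them. -/
theorem eq_or_add_eq_of_choose_eq {n i j : ℕ} (hi : i ≤ n) (hj : j ≤ n)
    (h : n.choose i = n.choose j) : i = j ∨ i + j = n := by
  have key : ∀ i j, 2 * i ≤ n → 2 * j ≤ n → n.choose i = n.choose j → i = j := by
    intro i j hi hj h
    rcases lt_trichotomy i j with h1 | h1 | h1
    · have := choose_lt_choose_of_lt_half h1 hj; omega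
    · exact h1
    · have := choose_lt_choose_of_lt_half h1 hi; omega
  rcases le_total (2 * i) n with h1 | h1 <;> rcases le_total (2 * j) n with h2 | h2
  · exact .inl (key i j h1 h2 h)
  · rw [← Nat.choose_symm hj] at h
    have := key _ _ h1 (by omega) h
    omega
  · rw [← Nat.choose_symm hi] at h
    have := key _ _ (by omega) h2 h
    omega
  · rw [← Nat.choose_symm hi, ← Nat.choose_symm hj] at h
    have := key _ _ (by omega) (by omega) h
    omega

/-- A balanced coloring in which no color occurs three times is symmetric. -/
theorem IsBalanced.symmetric {κ : Type*} {k : ℕ} {a : ℕ → κ} (h : IsBalanced k a)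
    (h3 : ∀ i j l, i < j → j < l → l < k → a i = a j → a i = a l → False) {i : ℕ} (hi : i < k) :
    a i = a (k - 1 - i) := by
  classical
  set s := (range k).filter fun j => a j = a i with hs
  have hsum : ∑ j ∈ s, apCoeff k j = 0 :=
    h s (filter_subset _ _) ⟨a i, fun j hj => by simp [hs, hj]⟩
  have his : i ∈ s := by simp [hs, hi]
  have hmem : ∀ j, j ∈ s → j < k ∧ a j = a i := fun j hj => by simpa [hs] using hj
  by_cases hj : ∃ j ∈ s, j ≠ i
  · obtain ⟨j, hj, hji⟩ := hj
    have hsij : s = {i, j} := by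
      ext l
      simp only [mem_insert, mem_singleton]
      refine ⟨fun hl => ?_, by rintro (rfl | rfl) <;> assumption⟩
      by_contra! hne
      obtain ⟨hjk, haj⟩ := hmem j hj
      obtain ⟨hlk, hal⟩ := hmem l hl
      rcases lt_or_gt_of_ne hji with h1 | h1 <;> rcases lt_or_gt_of_ne hne.1 with h2 | h2 <;>
        rcases lt_or_gt_of_ne hne.2 with h4 | h4 <;>
        first
        | omega
        | exact h3 _ _ _ h1 h2 ‹_› (by simp [*]) (by simp [*])
        | exact h3 _ _ _ h2 h1 ‹_› (by simp [*]) (by simp [*])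
        | exact h3 _ _ _ h4 h1 ‹_› (by simp [*]) (by simp [*])
        | exact h3 _ _ _ h1 h4 ‹_› (by simp [*]) (by simp [*])
        | exact h3 _ _ _ h2 h4 ‹_› (by simp [*]) (by simp [*])
        | exact h3 _ _ _ h4 h2 ‹_› (by simp [*]) (by simp [*])
    -- Two coefficients cancel only if their binomial coefficients agree, which places `j` opposite
    -- `i`.
    rw [hsij, sum_pair hji.symm] at hsum
    obtain ⟨hjk, haj⟩ := hmem j hj
    have habs : |apCoeff k i| = |apCoeff k j| := by
      rw [eq_neg_of_add_eq_zero_left hsum, abs_neg]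
    rw [abs_apCoeff, abs_apCoeff] at habs
    have := eq_or_add_eq_of_choose_eq (n := k - 1) (i := i) (j := j) (by omega) (by omega)
      (by exact_mod_cast habs)
    have hj' : j = k - 1 - i := by omega
    rw [← hj', haj]
  · push Not at hj
    have hsi : s = {i} := by
      ext l
      simp only [mem_singleton]
      exact ⟨hj l, by rintro rfl; exact his⟩
    rw [hsi, sum_singleton] at hsum
    exact absurd hsum (apCoeff_ne_zero hi)

/-! ### A coloring without monochromatic solutions of convex equations -/

/-- `x * K / b` is the index of `x` when `[0, b)` is cut into `K` blocks of length `b / K`. -/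
theorem abs_sub_mul_lt_of_div_eq {x y K b : ℕ} (hb : 0 < b) (h : x * K / b = y * K / b) :
    |(x : ℤ) - y| * K < b := by
  have h1 := Nat.div_add_mod (x * K) b
  have h2 := Nat.div_add_mod (y * K) b
  have h3 := Nat.mod_lt (x * K) hb
  have h4 := Nat.mod_lt (y * K) hb
  rw [h] at h1
  have h5 : |(x : ℤ) - y| * K = |(x * K : ℤ) - y * K| := by
    rw [← sub_mul, abs_mul, abs_of_nonneg (Int.natCast_nonneg K)]
  rw [h5, abs_lt]
  zify at h1 h2 h3 h4
  have h6 := Int.emod_nonneg (x * K : ℤ) (b := b) (by omega)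
  have h7 := Int.emod_nonneg (y * K : ℤ) (b := b) (by omega)
  constructor <;> linarith

/-- The expression is `p * (x - y) + q * (z - y)`, with total weight at most `k` on differences
below `b / k`. It serves twice: to exclude carries between digits, and to lift congruences modulo
`M` to equalities. -/
theorem abs_convex_lt {x y z : ℤ} {p q k b : ℕ} (hpq : p + q ≤ k) (hp : 0 < p)
    (hx : |x - y| * k < b) (hz : |z - y| * k < b) :
    |(p : ℤ) * x + q * z - (p + q) * y| < b := by
  have hk : (0 : ℤ) < k := by omega
  have e : (p : ℤ) * x + q * z - (p + q) * y = p * (x - y) + q * (z - y) := by ring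
  have h1 : |(p : ℤ) * x + q * z - (p + q) * y| ≤ p * |x - y| + q * |z - y| := by
    rw [e]
    refine (abs_add_le _ _).trans ?_
    rw [abs_mul, abs_mul, Nat.abs_cast, Nat.abs_cast]
  have hpq' : (p : ℤ) + q ≤ k := by exact_mod_cast hpq
  have hp' : (0 : ℤ) < p := by exact_mod_cast hp
  have hq' : (0 : ℤ) ≤ q := by positivity
  by_contra! hcon
  have h2 : (b : ℤ) * k ≤ (p * |x - y| + q * |z - y|) * k :=
    mul_le_mul_of_nonneg_right (hcon.trans h1) hk.le
  have h3 : (p : ℤ) * (|x - y| * k) < p * b := mul_lt_mul_of_pos_left hx hp'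
  have h4 : (q : ℤ) * (|z - y| * k) ≤ q * b := mul_le_mul_of_nonneg_left hz.le hq'
  have h5 : ((p : ℤ) + q) * b ≤ k * b := mul_le_mul_of_nonneg_right hpq' (by positivity)
  nlinarith

/-- Coloring a number with `D` digits in base `b` by the rough position of its digits and by the sum
of the squares of its digits, there is no nontrivial monochromatic solution of
`p * x + q * z = (p + q) * y` with `p + q ≤ k`. -/
theorem exists_coloring_convex (k b D : ℕ) (hk : 0 < k) (hb : 0 < b) :
    ∃ f : Fin (b ^ D) → (Fin D → Fin k) × Fin (D * b ^ 2 + 1),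
      ∀ x y z : Fin (b ^ D), ∀ p q : ℕ, 0 < p → 0 < q → p + q ≤ k → f x = f y → f z = f y →
        (p : ℤ) * (x : ℕ) + q * (z : ℕ) = (p + q) * (y : ℕ) → x = y := by
  have hsq : ∀ x : Fin D → Fin b, ∑ j, (x j : ℕ) ^ 2 < D * b ^ 2 + 1 := by
    intro x
    refine Nat.lt_succ_of_le ((sum_le_card_nsmul _ _ (b ^ 2) ?_).trans ?_)
    · exact fun j _ => Nat.pow_le_pow_left (x j).2.le 2
    · simp
  have hdiv : ∀ x : Fin b, (x : ℕ) * k / b < k := fun x =>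
    Nat.div_lt_of_lt_mul ((Nat.mul_lt_mul_right hk).2 x.2)
  let g : (Fin D → Fin b) → (Fin D → Fin k) × Fin (D * b ^ 2 + 1) := fun x =>
    (fun j => ⟨(x j : ℕ) * k / b, hdiv _⟩, ⟨∑ j, (x j : ℕ) ^ 2, hsq x⟩)
  have key : ∀ x y z : Fin D → Fin b, ∀ p q : ℕ, 0 < p → 0 < q → p + q ≤ k → g x = g y → g z = g y →
      (p : ℤ) * (finFunctionFinEquiv x : ℕ) + q * (finFunctionFinEquiv z : ℕ) =
        (p + q) * (finFunctionFinEquiv y : ℕ) → x = y := by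
    intro x y z p q hp hq hpq hxy hzy h
    have hx1 : ∀ j, |((x j : ℕ) : ℤ) - (y j : ℕ)| * k < b := fun j =>
      abs_sub_mul_lt_of_div_eq hb (congrArg Fin.val (congrFun (congrArg Prod.fst hxy) j))
    have hz1 : ∀ j, |((z j : ℕ) : ℤ) - (y j : ℕ)| * k < b := fun j =>
      abs_sub_mul_lt_of_div_eq hb (congrArg Fin.val (congrFun (congrArg Prod.fst hzy) j))
    have hx2 : ∑ j, (x j : ℕ) ^ 2 = ∑ j, (y j : ℕ) ^ 2 := congrArg Fin.val (congrArg Prod.snd hxy)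
    have hz2 : ∑ j, (z j : ℕ) ^ 2 = ∑ j, (y j : ℕ) ^ 2 := congrArg Fin.val (congrArg Prod.snd hzy)
    -- Digits in a common block are close enough that no carries occur, so the relation holds digit
    -- by digit.
    have hdig : ∀ j : Fin D,
        (p : ℤ) * (x j : ℕ) + q * (z j : ℕ) - (p + q) * (y j : ℕ) = 0 := by
      have h1 := eq_zero_of_sum_mul_pow_eq_zero (b := (b : ℤ)) (by exact_mod_cast hb) D
        (fun j => if hj : j < D then
          (p : ℤ) * (x ⟨j, hj⟩ : ℕ) + q * (z ⟨j, hj⟩ : ℕ) - (p + q) * (y ⟨j, hj⟩ : ℕ) else 0)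
        (fun j hj => by
          simp only [hj, dif_pos]
          exact abs_convex_lt hpq hp (hx1 _) (hz1 _)) (by
          rw [← Fin.sum_univ_eq_sum_range (fun j => (if hj : j < D then
            (p : ℤ) * (x ⟨j, hj⟩ : ℕ) + q * (z ⟨j, hj⟩ : ℕ) - (p + q) * (y ⟨j, hj⟩ : ℕ) else 0) *
              (b : ℤ) ^ j)]
          simp only [Fin.is_lt, dif_pos, Fin.eta]
          simp only [finFunctionFinEquiv_apply] at h
          push_cast at h
          rw [mul_sum, mul_sum, mul_sum, ← sum_add_distrib, ← sub_eq_zero, ← sum_sub_distrib] at h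
          rw [← h]
          exact sum_congr rfl fun j _ => by ring)
      intro j
      simpa using h1 j j.2
    -- The three digit vectors lie on a common sphere, and by strict convexity no point of a sphere
    -- is a proper convex combination of two distinct others.
    have hsum : (p * q : ℤ) * ∑ j, (((x j : ℕ) : ℤ) - (z j : ℕ)) ^ 2 = 0 := by
      have h1 : ∀ j, (p * q : ℤ) * (((x j : ℕ) : ℤ) - (z j : ℕ)) ^ 2 =
          (p + q) * (p * ((x j : ℕ) : ℤ) ^ 2 + q * ((z j : ℕ) : ℤ) ^ 2
            - (p + q) * ((y j : ℕ) : ℤ) ^ 2) := by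
        intro j
        have := hdig j
        linear_combination (-(p : ℤ) * (x j : ℕ) - q * (z j : ℕ) - (p + q) * (y j : ℕ)) * this
      rw [mul_sum, sum_congr rfl fun j _ => h1 j, ← mul_sum, sum_sub_distrib, sum_add_distrib,
        ← mul_sum, ← mul_sum, ← mul_sum]
      zify at hx2 hz2
      rw [hx2, hz2]
      ring
    have hpq0 : (p * q : ℤ) ≠ 0 := by positivity
    have h0 := (mul_eq_zero.1 hsum).resolve_left hpq0
    rw [sum_eq_zero_iff_of_nonneg fun j _ => sq_nonneg _] at h0
    funext j
    have h1 := pow_eq_zero_iff (two_ne_zero) |>.1 (h0 j (mem_univ j))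
    have h2 := hdig j
    have h3 : ((p : ℤ) + q) * (((x j : ℕ) : ℤ) - (y j : ℕ)) = 0 := by
      linear_combination h2 + q * h1
    have h4 : ((p : ℤ) + q) ≠ 0 := by positivity
    have h5 := (mul_eq_zero.1 h3).resolve_left h4
    apply Fin.ext
    omega
  refine ⟨fun n => g (finFunctionFinEquiv.symm n), fun x y z p q hp hq hpq hx hz h => ?_⟩
  have := key (finFunctionFinEquiv.symm x) (finFunctionFinEquiv.symm y) (finFunctionFinEquiv.symm z)
    p q hp hq hpq hx hz (by simpa using h)
  simpa using this

/-! ### Colorings of `ZMod M` without balanced progressions -/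

/-- If two consecutive terms of a progression in `ZMod M` and all pairs of symmetric terms are close
as integers, then the progression lifts to a progression of integers which wraps around
symmetrically. -/
theorem exists_lift_progression {M k : ℕ} [NeZero M] (hk : 2 ≤ k) (hke : Even k) {u e : ZMod M}
    (he : e ≠ 0)
    (hsym : ∀ i < k, |((u + i • e).val : ℤ) - ((u + (k - 1 - i) • e).val : ℤ)| * (2 * k : ℕ) < M) :
    ∃ n d : ℤ, d ≠ 0 ∧ ∀ i < k, ∃ m : ℤ, -1 ≤ m ∧ m ≤ 1 ∧
      n + i * d = (u + i • e).val + m * M ∧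
      n + ((k - 1 - i : ℕ) : ℤ) * d = (u + (k - 1 - i) • e).val + m * M := by
  obtain ⟨l, rfl⟩ := hke
  set v : ℕ → ℤ := fun i => ((u + i • e).val : ℤ) with hv
  have hvc : ∀ i, ((v i : ℤ) : ZMod M) = u + i • e := fun i => by simp [hv]
  have hv0 : ∀ i, 0 ≤ v i := fun i => Int.natCast_nonneg _
  have hvM : ∀ i, v i < M := fun i => by
    simp only [hv]; exact_mod_cast ZMod.val_lt (u + i • e)
  have hl : 1 ≤ l := by omega
  -- The two middle terms are both consecutive and symmetric, so their integer difference is a small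
  -- lift of `e`.
  set d : ℤ := v l - v (l - 1) with hd
  have hdabs : |d| * (2 * (l + l) : ℕ) < M := by
    have := hsym l (by omega)
    rwa [show l + l - 1 - l = l - 1 by omega] at this
  have hdc : (d : ZMod M) = e := by
    rw [hd]; push_cast
    rw [hvc, hvc]
    obtain ⟨t, rfl⟩ : ∃ t, l = t + 1 := ⟨l - 1, by omega⟩
    simp only [Nat.add_sub_cancel, succ_nsmul]
    abel
  have hd0 : d ≠ 0 := by
    rintro h0
    rw [h0] at hdc
    exact he (by simpa using hdc.symm)
  set n : ℤ := v (l - 1) - ((l - 1 : ℕ) : ℤ) * d with hn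
  have hM : (0 : ℤ) < M := by exact_mod_cast NeZero.pos M
  -- Each lifted term is within `M` of `v (l - 1)`, hence lies strictly between `-M` and `2 * M`.
  have hx : ∀ i < l + l, ∃ m : ℤ, -1 ≤ m ∧ m ≤ 1 ∧ n + i * d = v i + m * M := by
    intro i hi
    have hdvd : (M : ℤ) ∣ (n + i * d) - v i := by
      rw [← ZMod.intCast_zmod_eq_zero_iff_dvd]
      rw [hn]
      push_cast
      rw [hvc, hvc, hdc, nsmul_eq_mul, nsmul_eq_mul]
      ring
    obtain ⟨m, hm⟩ := hdvd
    have h1 : |((i : ℤ) - ((l - 1 : ℕ) : ℤ)) * d| < M := by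
      rw [abs_mul]
      have h2 : |(i : ℤ) - ((l - 1 : ℕ) : ℤ)| ≤ (2 * (l + l) : ℕ) := by
        rw [abs_le]; constructor <;> push_cast <;> omega
      calc _ ≤ ((2 * (l + l) : ℕ) : ℤ) * |d| := mul_le_mul_of_nonneg_right h2 (abs_nonneg _)
        _ < M := by rwa [mul_comm]
    rw [abs_lt] at h1
    have h3 : n + i * d = v (l - 1) + ((i : ℤ) - ((l - 1 : ℕ) : ℤ)) * d := by rw [hn]; ring
    have h4 := hv0 i
    have h5 := hvM i
    have h6 := hv0 (l - 1)
    have h7 := hvM (l - 1)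
    refine ⟨m, ?_, ?_, ?_⟩
    · by_contra! hc
      have : (M : ℤ) * m ≤ M * (-2) := mul_le_mul_of_nonneg_left (by omega) hM.le
      linarith
    · by_contra! hc
      have : (M : ℤ) * 2 ≤ M * m := mul_le_mul_of_nonneg_left (by omega) hM.le
      linarith
    · linarith
  refine ⟨n, d, hd0, fun i hi => ?_⟩
  obtain ⟨m, hm1, hm2, hm⟩ := hx i hi
  obtain ⟨m', hm1', hm2', hm'⟩ := hx (l + l - 1 - i) (by omega)
  refine ⟨m, hm1, hm2, hm, ?_⟩
  -- Symmetric terms wrap equally often: `(m - m') * M` is a multiple of `d` below `M / 2` in size,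
  -- minus a difference of residues also below `M / 2`.
  suffices m' = m by rw [← this]; exact hm'
  have hs : |v i - v (l + l - 1 - i)| * (2 * (l + l) : ℕ) < M := hsym i hi
  have h1 : (m - m') * M = ((i : ℤ) - ((l + l - 1 - i : ℕ) : ℤ)) * d
      - (v i - v (l + l - 1 - i)) := by linear_combination hm' - hm
  have h2 : |(i : ℤ) - ((l + l - 1 - i : ℕ) : ℤ)| ≤ (l + l : ℕ) := by
    rw [abs_le]; constructor <;> omega
  have h3 : |(m - m') * M| < M := by
    rw [h1]
    refine (abs_sub _ _).trans_lt ?_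
    rw [abs_mul]
    have h4 : |(i : ℤ) - ((l + l - 1 - i : ℕ) : ℤ)| * |d| ≤ (l + l : ℕ) * |d| :=
      mul_le_mul_of_nonneg_right h2 (abs_nonneg _)
    have h5 : |v i - v (l + l - 1 - i)| * 2 ≤ |v i - v (l + l - 1 - i)| * (2 * (l + l) : ℕ) :=
      mul_le_mul_of_nonneg_left (by push_cast; omega) (abs_nonneg _)
    push_cast at *
    linarith
  rw [abs_mul, abs_of_pos hM] at h3
  have h6 : |m - m'| < 1 := by
    by_contra! hc
    have := mul_le_mul_of_nonneg_right hc hM.le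
    linarith
  rw [Int.abs_lt_one_iff] at h6
  omega

theorem add_nsmul_convex {M : ℕ} (u e : ZMod M) {i j l : ℕ} (hij : i < j) (hjl : j < l) :
    ((l - j : ℕ) : ZMod M) * (u + i • e) + ((j - i : ℕ) : ZMod M) * (u + l • e) =
      ((l - j : ℕ) + (j - i : ℕ)) * (u + j • e) := by
  rw [Nat.cast_sub hij.le, Nat.cast_sub hjl.le, nsmul_eq_mul, nsmul_eq_mul, nsmul_eq_mul]
  ring

/-- The number of colors used in `exists_zmod_coloring_of_coloring`. -/
def zmodColorCount (k r b D : ℕ) : ℕ := r ^ 3 * (2 * k) * (k ^ D * (D * b ^ 2 + 1))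

/-- The new color has three ingredients: the colors under `φ` of three translates, which absorb
wraparound; one of `2 * k` blocks, which makes equally colored residues close; and a Behrend-type
color, which excludes three equal terms of a progression. -/
theorem exists_zmod_coloring_of_coloring {k M r b D : ℕ} (hk : 2 ≤ k) (hke : Even k)
    (hM : M.Prime) (hkM : k < M) (hb : 0 < b) (hMb : M ≤ b ^ D) {φ : ℤ → Fin r}
    (hφ : ¬ HasSymmetricallyColoredAP k (3 * M) φ) :
    ∃ ψ : ZMod M → Fin (zmodColorCount k r b D),
      ∀ u e : ZMod M, e ≠ 0 → ¬ IsBalanced k (fun i => ψ (u + i • e)) := by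
  have : Fact M.Prime := ⟨hM⟩
  have hM0 := hM.pos
  obtain ⟨f, hf⟩ := exists_coloring_convex k b D (by omega) hb
  let fin : ZMod M → Fin (b ^ D) := fun u => ⟨u.val, (ZMod.val_lt u).trans_le hMb⟩
  let blk : ZMod M → Fin (2 * k) := fun u =>
    ⟨u.val * (2 * k) / M, Nat.div_lt_of_lt_mul
      ((Nat.mul_lt_mul_right (by omega)).2 (ZMod.val_lt u))⟩
  -- The index `t` stands for the wraparound `m + 1`, and the final `+ 1` moves residues starting at
  -- `0` into `[3M]`, which starts at `1`.
  let sh : ZMod M → Fin 3 → Fin r := fun u t => φ (u.val + (t : ℕ) * M + 1)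
  let χ : ZMod M → ((Fin 3 → Fin r) × Fin (2 * k)) × ((Fin D → Fin k) × Fin (D * b ^ 2 + 1)) :=
    fun u => ((sh u, blk u), f (fin u))
  have hcard : Fintype.card (((Fin 3 → Fin r) × Fin (2 * k)) ×
      ((Fin D → Fin k) × Fin (D * b ^ 2 + 1))) = zmodColorCount k r b D := by
    simp [zmodColorCount]
  let E := Fintype.equivFinOfCardEq hcard
  refine ⟨fun u => E (χ u), fun u e he hbal => hφ ?_⟩
  have hbal' : IsBalanced k (fun i => χ (u + i • e)) := hbal.of_comp E.injective
  have hclose : ∀ x y : ZMod M, χ x = χ y → |(x.val : ℤ) - y.val| * (2 * k : ℕ) < M := fun x y h =>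
    abs_sub_mul_lt_of_div_eq hM0 (congrArg Fin.val (congrArg (fun t => t.1.2) h))
  have hthree : ∀ i j l, i < j → j < l → l < k → χ (u + i • e) = χ (u + j • e) →
      χ (u + i • e) = χ (u + l • e) → False := by
    intro i j l hij hjl hl h1 h2
    have hlin : ((l - j : ℕ) : ℤ) * ((u + i • e).val : ℕ) + ((j - i : ℕ) : ℤ) * ((u + l • e).val : ℕ)
        = ((l - j : ℕ) + (j - i : ℕ)) * ((u + j • e).val : ℕ) := by
      rw [← sub_eq_zero]
      refine Int.eq_zero_of_abs_lt_dvd (m := M) ?_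
        (abs_convex_lt (k := 2 * k) (by omega) (by omega) (hclose _ _ h1)
          (hclose _ _ (h2.symm.trans h1)))
      rw [← ZMod.intCast_zmod_eq_zero_iff_dvd]
      have := add_nsmul_convex u e hij hjl
      simp only [Int.cast_sub, Int.cast_mul, Int.cast_add, Int.cast_natCast]
      rw [ZMod.natCast_zmod_val, ZMod.natCast_zmod_val, ZMod.natCast_zmod_val, this, sub_self]
    have h3 := hf (fin (u + i • e)) (fin (u + j • e)) (fin (u + l • e)) (l - j) (j - i) (by omega)
      (by omega) (by omega) (congrArg Prod.snd h1) (congrArg Prod.snd (h2.symm.trans h1)) hlin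
    have h4 : u + i • e = u + j • e := ZMod.val_injective M (congrArg Fin.val h3)
    have h5 : ((j - i : ℕ) : ZMod M) * e = 0 := by
      have := add_left_cancel h4
      rw [Nat.cast_sub hij.le, sub_mul, ← nsmul_eq_mul, ← nsmul_eq_mul, this, sub_self]
    rcases mul_eq_zero.1 h5 with h6 | h6
    · rw [ZMod.natCast_eq_zero_iff] at h6
      have := Nat.le_of_dvd (by omega) h6
      omega
    · exact he h6
  have hsym : ∀ i < k, χ (u + i • e) = χ (u + (k - 1 - i) • e) := fun i hi =>
    hbal'.symmetric hthree hi
  obtain ⟨n, d, hd, hnd⟩ := exists_lift_progression hk hke he fun i hi => hclose _ _ (hsym i hi)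
  refine ⟨n + M + 1, d, hd, fun i hi => ?_, fun i hi => ?_⟩
  · obtain ⟨m, hm1, hm2, hm, -⟩ := hnd i (mem_range.1 hi)
    have h1 : ((u + i • e).val : ℤ) < M := by exact_mod_cast ZMod.val_lt _
    have h2 : (0 : ℤ) ≤ ((u + i • e).val : ℤ) := by positivity
    have h3 : (0 : ℤ) ≤ (m + 1) * M := mul_nonneg (by omega) (by omega)
    have h4 : m * M ≤ 1 * M := mul_le_mul_of_nonneg_right hm2 (by omega)
    rw [Set.mem_Icc]
    push_cast
    constructor <;> linarith
  · rw [mem_Icc] at hi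
    have hi' : i - 1 < k := by omega
    obtain ⟨m, hm1, hm2, hm, hm'⟩ := hnd (i - 1) hi'
    have hsh := congrArg (fun t => t.1.1) (hsym (i - 1) hi')
    obtain ⟨t, ht⟩ : ∃ t : Fin 3, ((t : ℕ) : ℤ) = m + 1 := by
      refine ⟨⟨(m + 1).toNat, by omega⟩, ?_⟩
      simp only
      omega
    have h1 := congrFun hsh t
    have e1 : ((i - 1 : ℕ) : ℤ) = (i : ℤ) - 1 := by omega
    have e2 : ((k - 1 - (i - 1) : ℕ) : ℤ) = (k : ℤ) - i := by omega
    rw [e1] at hm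
    rw [e2] at hm'
    convert h1 using 2
    · rw [ht]; linarith
    · rw [ht]; linarith

/-- From symmetric-progression-free colorings of intervals with few colors one gets colorings of
`ZMod M` with few colors and without balanced progressions. -/
theorem exists_zmod_coloring {k : ℕ} (hk : 2 ≤ k) (hke : Even k)
    (hcol : ∃ g : ℕ → ℝ, Filter.Tendsto g Filter.atTop (nhds 0) ∧
      ∀ N : ℕ, 1 ≤ N → ∃ r : ℕ, (r : ℝ) ≤ (N : ℝ) ^ g N ∧
        ∃ φ : ℤ → Fin r, ¬ HasSymmetricallyColoredAP k N φ) {ε : ℝ} (hε : 0 < ε) :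
    ∃ M₀ : ℕ, ∀ M : ℕ, M.Prime → M₀ ≤ M → ∃ R : ℕ, (R : ℝ) ≤ (M : ℝ) ^ ε ∧
      ∃ ψ : ZMod M → Fin R, ∀ u e : ZMod M, e ≠ 0 → ¬ IsBalanced k (fun i => ψ (u + i • e)) := by
  obtain ⟨g, hg, hcol⟩ := hcol
  -- With `b` about `M ^ (1 / D)` this gives `b ^ 2` at most a constant times `M ^ (ε / 4)`. Another
  -- `ε / 4` pays for `r ^ 3` and another for the constants.
  obtain ⟨D, hD⟩ := exists_nat_gt (8 / ε)
  have hD0 : (0 : ℝ) < D := lt_trans (by positivity) hD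
  have hDn : 0 < D := by exact_mod_cast hD0
  have h2D : (2 : ℝ) / D < ε / 4 := by
    rw [div_lt_iff₀ hε] at hD
    rw [div_lt_iff₀ hD0]
    linarith
  -- the constants to be absorbed
  set K : ℝ := 2 * k * (k ^ D * (D * 4 + 1)) * 3 ^ (ε / 4) with hK
  have hbig : ∀ᶠ M : ℕ in Filter.atTop, K ≤ (M : ℝ) ^ (ε / 4) :=
    ((tendsto_rpow_atTop (by positivity : 0 < ε / 4)).comp
      tendsto_natCast_atTop_atTop).eventually_ge_atTop K
  have hgs : ∀ᶠ M : ℕ in Filter.atTop, g (3 * M) < ε / 12 := by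
    have h3 : Filter.Tendsto (fun M : ℕ => 3 * M) Filter.atTop Filter.atTop :=
      Filter.tendsto_id.const_mul_atTop' (by norm_num)
    exact (hg.comp h3).eventually (gt_mem_nhds (by positivity))
  obtain ⟨M₀, hM₀⟩ := Filter.eventually_atTop.1
    (hbig.and (hgs.and (Filter.eventually_gt_atTop k)))
  refine ⟨M₀, fun M hM hMM => ?_⟩
  obtain ⟨hKM, hgM, hkM⟩ := hM₀ M hMM
  have hM1 : (1 : ℝ) ≤ M := by exact_mod_cast hM.one_le
  have hMpos : (0 : ℝ) < M := by linarith
  obtain ⟨r, hr, φ, hφ⟩ := hcol (3 * M) (by have := hM.pos; omega)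
  set y : ℝ := (M : ℝ) ^ ((1 : ℝ) / D) with hy
  have hy1 : 1 ≤ y := Real.one_le_rpow hM1 (by positivity)
  set b : ℕ := ⌈y⌉₊ with hb
  have hb0 : 0 < b := Nat.ceil_pos.2 (by linarith)
  have hyD : y ^ D = M := by
    rw [hy, one_div, Real.rpow_inv_natCast_pow hMpos.le hDn.ne']
  have hMb : M ≤ b ^ D := by
    have : (M : ℝ) ≤ (b : ℝ) ^ D := by
      rw [← hyD]
      exact pow_le_pow_left₀ (by linarith) (Nat.le_ceil y) D
    exact_mod_cast this
  have hb2 : (b : ℝ) ≤ 2 * y := by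
    have := Nat.ceil_lt_add_one (show 0 ≤ y by linarith)
    linarith
  obtain ⟨ψ, hψ⟩ := exists_zmod_coloring_of_coloring hk hke hM hkM hb0 hMb hφ
  refine ⟨_, ?_, ψ, hψ⟩
  have hr3 : (r : ℝ) ^ 3 ≤ 3 ^ (ε / 4) * (M : ℝ) ^ (ε / 4) := by
    have h1 : (r : ℝ) ≤ (3 * M : ℝ) ^ (ε / 12) := by
      refine hr.trans ?_
      push_cast
      exact Real.rpow_le_rpow_of_exponent_le (by linarith) hgM.le
    calc (r : ℝ) ^ 3 ≤ ((3 * M : ℝ) ^ (ε / 12)) ^ 3 := pow_le_pow_left₀ (by positivity) h1 3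
      _ = (3 * M : ℝ) ^ (ε / 4) := by
        rw [← Real.rpow_natCast, ← Real.rpow_mul (by positivity)]
        congr 1
        push_cast
        ring
      _ = _ := Real.mul_rpow (by norm_num) hMpos.le
  have hy2 : y ^ 2 ≤ (M : ℝ) ^ (ε / 4) := by
    rw [hy, ← Real.rpow_natCast, ← Real.rpow_mul hMpos.le]
    refine Real.rpow_le_rpow_of_exponent_le hM1 ?_
    push_cast
    linarith [show (1 : ℝ) / D * 2 = 2 / D by ring]
  have hMe : 1 ≤ (M : ℝ) ^ (ε / 4) := Real.one_le_rpow hM1 (by positivity)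
  have hlast : (D : ℝ) * (b : ℝ) ^ 2 + 1 ≤ (D * 4 + 1) * (M : ℝ) ^ (ε / 4) := by
    have : (b : ℝ) ^ 2 ≤ 4 * (M : ℝ) ^ (ε / 4) := by
      calc (b : ℝ) ^ 2 ≤ (2 * y) ^ 2 := pow_le_pow_left₀ (by positivity) hb2 2
        _ = 4 * y ^ 2 := by ring
        _ ≤ _ := by linarith
    have := mul_le_mul_of_nonneg_left this hD0.le
    linarith
  calc ((zmodColorCount k r b D : ℕ) : ℝ)
      = (r : ℝ) ^ 3 * (2 * k) * (k ^ D * (D * (b : ℝ) ^ 2 + 1)) := by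
        simp [zmodColorCount]
    _ ≤ (3 ^ (ε / 4) * (M : ℝ) ^ (ε / 4)) * (2 * k) * (k ^ D * ((D * 4 + 1) * (M : ℝ) ^ (ε / 4))) := by
        gcongr
    _ = K * ((M : ℝ) ^ (ε / 4) * (M : ℝ) ^ (ε / 4)) := by rw [hK]; ring
    _ ≤ (M : ℝ) ^ (ε / 4) * ((M : ℝ) ^ (ε / 4) * (M : ℝ) ^ (ε / 4)) := by gcongr
    _ = (M : ℝ) ^ (3 * (ε / 4)) := by
        rw [← Real.rpow_add hMpos, ← Real.rpow_add hMpos]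
        congr 1
        ring
    _ ≤ (M : ℝ) ^ ε := Real.rpow_le_rpow_of_exponent_le hM1 (by linarith)

/-! ### Gowers averages and the Cauchy–Schwarz inequality -/

section Gowers

variable {G : Type*} [AddCommGroup G]

theorem iterMulDeriv_mul_conj_sub (s : ℕ) (t : Fin s → G) (f g : G → ℂ) (h n : G) :
    iterMulDeriv s t (fun m => f m * starRingEnd ℂ (g (m - h))) n =
      iterMulDeriv s t f n * starRingEnd ℂ (iterMulDeriv s t g (n - h)) := by
  induction s generalizing n with
  | zero => rfl
  | succ s ih =>
    simp only [iterMulDeriv, mulDeriv, ih, map_mul, Complex.conj_conj, sub_right_comm n h]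
    ring

theorem iterMulDeriv_comp_addEquiv {H : Type*} [AddCommGroup H] (e : G ≃+ H) (s : ℕ)
    (t : Fin s → G) (f : H → ℂ) (n : G) :
    iterMulDeriv s t (fun m => f (e m)) n = iterMulDeriv s (fun i => e (t i)) f (e n) := by
  induction s generalizing n with
  | zero => rfl
  | succ s ih =>
    simp only [iterMulDeriv, mulDeriv, ih, map_sub]
    rfl

variable [Fintype G]

/-- For fixed `n`, substituting `n - h` for `h` decouples the two factors. This identity underlies
the Cauchy–Schwarz step. -/
theorem expect_gowersAverage_mul_conj_sub (s : ℕ) (f g : G → ℂ) :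
    𝔼 h, gowersAverage s (fun m => f m * starRingEnd ℂ (g (m - h))) =
      𝔼 t : Fin s → G, (𝔼 n, iterMulDeriv s t f n) *
        starRingEnd ℂ (𝔼 n, iterMulDeriv s t g n) := by
  unfold gowersAverage
  simp only [iterMulDeriv_mul_conj_sub]
  have h1 : ∀ h : G, (𝔼 n : G, 𝔼 t : Fin s → G,
      iterMulDeriv s t f n * starRingEnd ℂ (iterMulDeriv s t g (n - h))) =
      𝔼 t : Fin s → G, 𝔼 n : G,
        iterMulDeriv s t f n * starRingEnd ℂ (iterMulDeriv s t g (n - h)) :=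
    fun h => expect_comm _ _ _
  simp only [h1]
  rw [expect_comm]
  refine expect_congr rfl fun t _ => ?_
  rw [expect_comm, map_expect, expect_mul]
  refine expect_congr rfl fun n _ => ?_
  rw [← mul_expect]
  congr 1
  exact Fintype.expect_equiv (Equiv.subLeft n) _ _ fun h => rfl

/-- The definition applies the new derivative outermost, here it is innermost; both averages equal
the same average of squared absolute values. -/
theorem gowersAverage_succ (s : ℕ) (f : G → ℂ) :
    gowersAverage (s + 1) f = 𝔼 h, gowersAverage s (mulDeriv h f) := by
  have h0 := expect_gowersAverage_mul_conj_sub s f f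
  refine Eq.trans ?_ h0.symm
  unfold gowersAverage
  rw [Finset.expect_comm]
  rw [← Fintype.expect_equiv (Fin.consEquiv (fun _ => G))
    (fun p : G × (Fin s → G) => 𝔼 n : G, iterMulDeriv (s + 1) (Fin.cons p.1 p.2) f n) _
    (fun p => rfl)]
  rw [← Finset.univ_product_univ, Finset.expect_product, Finset.expect_comm]
  refine Finset.expect_congr rfl fun t _ => ?_
  rw [Finset.expect_comm, map_expect, Finset.expect_mul]
  refine Finset.expect_congr rfl fun n _ => ?_
  simp only [iterMulDeriv, mulDeriv, Fin.cons_zero, Fin.tail_cons]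
  rw [← Finset.mul_expect]
  congr 1
  exact Fintype.expect_equiv (Equiv.subLeft n) _ _ fun h => rfl

theorem gowersAverage_zero (f : G → ℂ) : gowersAverage 0 f = 𝔼 n, f n := by
  simp [gowersAverage, iterMulDeriv]

theorem gowersAverage_one (f : G → ℂ) :
    gowersAverage 1 f = (𝔼 n, f n) * starRingEnd ℂ (𝔼 n, f n) := by
  rw [gowersAverage_succ]
  refine (expect_gowersAverage_mul_conj_sub 0 f f).trans ?_
  simp [iterMulDeriv]

theorem norm_expect_le_of_le {ι : Type*} [Fintype ι] [Nonempty ι] {f : ι → ℂ} {B : ℝ}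
    (hf : ∀ i, ‖f i‖ ≤ B) : ‖𝔼 i, f i‖ ≤ B :=
  (RCLike.norm_expect_le (K := ℂ)).trans (expect_le univ_nonempty fun i _ => hf i)

theorem norm_gowersAverage_le {s : ℕ} {f : G → ℂ} {B : ℝ} (hf : ∀ n, ‖f n‖ ≤ B) :
    ‖gowersAverage s f‖ ≤ B ^ 2 ^ s := by
  induction s generalizing f B with
  | zero => simpa [gowersAverage_zero] using norm_expect_le_of_le hf
  | succ s ih =>
    rw [gowersAverage_succ]
    refine norm_expect_le_of_le fun h => ?_
    have hB : ∀ n, ‖mulDeriv h f n‖ ≤ B ^ 2 := fun n => by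
      rw [mulDeriv, norm_mul, RCLike.norm_conj, sq]
      exact mul_le_mul (hf _) (hf _) (norm_nonneg _) ((norm_nonneg _).trans (hf n))
    refine (ih hB).trans_eq ?_
    rw [← pow_mul, pow_succ' 2 s]

/-- The Cauchy–Schwarz inequality splitting one direction of a Gowers average. -/
theorem norm_expect_gowersAverage_sq_le (s : ℕ) (f g : G → ℂ) :
    ‖𝔼 h, gowersAverage s (fun m => f m * starRingEnd ℂ (g (m - h)))‖ ^ 2 ≤
      ‖gowersAverage (s + 1) f‖ * ‖gowersAverage (s + 1) g‖ := by
  have hself : ∀ f : G → ℂ, ‖gowersAverage (s + 1) f‖ =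
      𝔼 t : Fin s → G, ‖𝔼 n, iterMulDeriv s t f n‖ ^ 2 := by
    intro f
    have h1 : gowersAverage (s + 1) f =
        ((𝔼 t : Fin s → G, ‖𝔼 n, iterMulDeriv s t f n‖ ^ 2 : ℝ) : ℂ) := by
      rw [gowersAverage_succ]
      refine (expect_gowersAverage_mul_conj_sub s f f).trans ?_
      refine Eq.trans ?_ (map_expect Complex.ofRealHom _ _).symm
      refine expect_congr rfl fun t _ => ?_
      rw [Complex.mul_conj, Complex.normSq_eq_norm_sq]
      rfl
    rw [h1, Complex.norm_real, Real.norm_of_nonneg (expect_nonneg fun t _ => by positivity)]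
  rw [expect_gowersAverage_mul_conj_sub, hself, hself]
  refine (pow_le_pow_left₀ (norm_nonneg _) (RCLike.norm_expect_le (K := ℂ)) 2).trans ?_
  simp only [norm_mul, RCLike.norm_conj]
  exact expect_mul_sq_le_sq_mul_sq _ _ _

theorem expect_pow_le_expect_pow {ι : Type*} [Fintype ι] [Nonempty ι] {x : ι → ℝ}
    (hx : ∀ i, 0 ≤ x i) (n : ℕ) : (𝔼 i, x i) ^ n ≤ 𝔼 i, x i ^ n := by
  have hc : (Fintype.card ι : ℝ) ≠ 0 := by exact_mod_cast Fintype.card_ne_zero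
  have h := Real.pow_arith_mean_le_arith_mean_pow univ (fun _ : ι => (Fintype.card ι : ℝ)⁻¹) x
    (fun _ _ => by positivity) (by simp [hc]) (fun i _ => hx i) n
  rw [← mul_sum, ← mul_sum] at h
  rw [Fintype.expect_eq_sum_div_card, Fintype.expect_eq_sum_div_card]
  simpa [div_eq_inv_mul] using h

/-- The Gowers average of `f` in which the factor `f n` is replaced by `g n`. -/
noncomputable def cornerAverage : ℕ → (G → ℂ) → (G → ℂ) → ℂ
  | 0, g, _ => 𝔼 n, g n
  | s + 1, g, f => 𝔼 h, cornerAverage s (fun m => g m * starRingEnd ℂ (f (m - h))) (mulDeriv h f)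

theorem cornerAverage_self (s : ℕ) (f : G → ℂ) : cornerAverage s f f = gowersAverage s f := by
  induction s generalizing f with
  | zero => exact (gowersAverage_zero f).symm
  | succ s ih =>
    rw [gowersAverage_succ]
    exact expect_congr rfl fun h _ => ih _

/-- Linearity in the distinguished factor allows a Fourier expansion to be inserted there alone,
while the other factors only need to be bounded by `1`. -/
theorem cornerAverage_sum {ι : Type*} (I : Finset ι) (s : ℕ) (g : ι → G → ℂ) (f : G → ℂ) :
    cornerAverage s (fun n => ∑ i ∈ I, g i n) f = ∑ i ∈ I, cornerAverage s (g i) f := by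
  induction s generalizing g f with
  | zero => exact expect_sum_comm _ _ _
  | succ s ih =>
    simp only [cornerAverage, sum_mul, ih]
    exact expect_sum_comm _ _ _

/-- A one-sided Gowers–Cauchy–Schwarz inequality. -/
theorem norm_cornerAverage_pow_le {s : ℕ} (hs : 1 ≤ s) {g f : G → ℂ} (hf : ∀ n, ‖f n‖ ≤ 1) :
    ‖cornerAverage s g f‖ ^ 2 ^ s ≤ ‖gowersAverage s g‖ := by
  induction s, hs using Nat.le_induction generalizing g f with
  | base =>
    have h1 : cornerAverage 1 g f = 𝔼 h, gowersAverage 0 (fun m => g m * starRingEnd ℂ (f (m - h))) :=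
      expect_congr rfl fun h _ => (gowersAverage_zero _).symm
    rw [h1, pow_one]
    refine (norm_expect_gowersAverage_sq_le 0 g f).trans ?_
    refine mul_le_of_le_one_right (norm_nonneg _) ?_
    simpa using norm_gowersAverage_le (s := 0 + 1) hf
  | succ s hs ih =>
    have hpos : ∀ u : G → ℂ, gowersAverage s u = (‖gowersAverage s u‖ : ℂ) := by
      intro u
      obtain ⟨x, hx, hux⟩ := gowersAverage_nonneg hs u
      rw [hux, Complex.norm_real, Real.norm_of_nonneg hx]
    have hmul : ∀ h, ∀ n, ‖mulDeriv h f n‖ ≤ 1 := fun h n => by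
      rw [mulDeriv, norm_mul, RCLike.norm_conj]
      exact mul_le_one₀ (hf _) (norm_nonneg _) (hf _)
    -- After the power mean inequality and the induction hypothesis, the Gowers averages are
    -- nonnegative reals, so their norms can be dropped before Cauchy–Schwarz is applied.
    have h1 : ‖cornerAverage (s + 1) g f‖ ^ 2 ^ s ≤
        ‖𝔼 h, gowersAverage s (fun m => g m * starRingEnd ℂ (f (m - h)))‖ := by
      calc ‖cornerAverage (s + 1) g f‖ ^ 2 ^ s
          ≤ (𝔼 h, ‖cornerAverage s (fun m => g m * starRingEnd ℂ (f (m - h)))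
              (mulDeriv h f)‖) ^ 2 ^ s :=
            pow_le_pow_left₀ (norm_nonneg _) (RCLike.norm_expect_le (K := ℂ)) _
        _ ≤ 𝔼 h, ‖cornerAverage s (fun m => g m * starRingEnd ℂ (f (m - h)))
              (mulDeriv h f)‖ ^ 2 ^ s := expect_pow_le_expect_pow (fun _ => norm_nonneg _) _
        _ ≤ 𝔼 h, ‖gowersAverage s (fun m => g m * starRingEnd ℂ (f (m - h)))‖ :=
            expect_le_expect fun h _ => ih (hmul h)
        _ = ‖((𝔼 h, ‖gowersAverage s (fun m => g m * starRingEnd ℂ (f (m - h)))‖ : ℝ) : ℂ)‖ := by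
            rw [Complex.norm_real, Real.norm_of_nonneg (expect_nonneg fun _ _ => norm_nonneg _)]
        _ = _ := by
            congr 1
            refine (map_expect Complex.ofRealHom _ _).trans ?_
            exact expect_congr rfl fun h _ => (hpos _).symm
    calc ‖cornerAverage (s + 1) g f‖ ^ 2 ^ (s + 1)
        = (‖cornerAverage (s + 1) g f‖ ^ 2 ^ s) ^ 2 := by rw [← pow_mul, pow_succ]
      _ ≤ _ := pow_le_pow_left₀ (by positivity) h1 2
      _ ≤ _ := norm_expect_gowersAverage_sq_le s g f
      _ ≤ _ := by
        refine mul_le_of_le_one_right (norm_nonneg _) ?_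
        simpa using norm_gowersAverage_le (s := s + 1) hf

theorem norm_cornerAverage_le {s : ℕ} {g f : G → ℂ} {B : ℝ} (hg : ∀ n, ‖g n‖ ≤ B)
    (hf : ∀ n, ‖f n‖ ≤ 1) : ‖cornerAverage s g f‖ ≤ B := by
  induction s generalizing g f with
  | zero => exact norm_expect_le_of_le hg
  | succ s ih =>
    refine norm_expect_le_of_le fun h => ih (fun n => ?_) fun n => ?_
    · rw [norm_mul, RCLike.norm_conj]
      exact (mul_le_of_le_one_right (norm_nonneg _) (hf _)).trans (hg n)
    · rw [mulDeriv, norm_mul, RCLike.norm_conj]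
      exact mul_le_one₀ (hf _) (norm_nonneg _) (hf _)

theorem gowersNorm_le_of_norm_gowersAverage_le {s : ℕ} {f : G → ℂ} {η : ℝ} (hη : 0 ≤ η)
    (h : ‖gowersAverage s f‖ ≤ η ^ 2 ^ s) : gowersNorm s f ≤ η := by
  unfold gowersNorm
  calc _ ≤ (η ^ 2 ^ s) ^ ((1 : ℝ) / 2 ^ s) :=
        Real.rpow_le_rpow (norm_nonneg _) h (by positivity)
    _ = η := by
        rw [← Real.rpow_natCast, ← Real.rpow_mul hη]
        simp

/-! ### Transfer along isomorphisms -/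

theorem gowersNorm_comp_addEquiv {H : Type*} [AddCommGroup H] [Fintype H] (e : G ≃+ H) (s : ℕ)
    (f : H → ℂ) : gowersNorm s (fun m => f (e m)) = gowersNorm s f := by
  unfold gowersNorm
  congr 2
  refine Fintype.expect_equiv e.toEquiv _ _ fun n => ?_
  refine Fintype.expect_equiv (Equiv.arrowCongr (Equiv.refl _) e.toEquiv) _ _ fun t => ?_
  exact iterMulDeriv_comp_addEquiv e s t f n

theorem apDensity_preimage_addEquiv {H : Type*} [AddCommGroup H] [Fintype H] (e : G ≃+ H) (k : ℕ)
    (A : Set H) : apDensity k (e ⁻¹' A) = apDensity k A := by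
  refine Fintype.expect_equiv e.toEquiv _ _ fun n => ?_
  refine Fintype.expect_equiv e.toEquiv _ _ fun d => ?_
  refine prod_congr rfl fun i _ => ?_
  have h : e (n + i • d) = e.toEquiv n + i • e.toEquiv d := by
    rw [map_add, map_nsmul]
    rfl
  rw [← h]
  exact Set.indicator_comp_right (s := A) (g := fun _ => (1 : ℝ)) e

end Gowers

/-! ### Polynomial phases -/

/-- The additive derivative of a polynomial of degree at most `s + 1`. -/
theorem natDegree_sub_taylor_le {R : Type*} [CommRing R] {s : ℕ} (p : Polynomial R)
    (hp : p.natDegree ≤ s + 1) (h : R) :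
    (p - Polynomial.taylor (-h) p).natDegree ≤ s ∧
      (p - Polynomial.taylor (-h) p).coeff s = (s + 1) * p.coeff (s + 1) * h := by
  constructor
  · rw [Polynomial.natDegree_le_iff_coeff_eq_zero]
    intro n hn
    rw [Polynomial.coeff_sub, Polynomial.taylor_coeff]
    have hd := Polynomial.natDegree_hasseDeriv_le p n
    rw [Polynomial.eq_C_of_natDegree_le_zero (p := Polynomial.hasseDeriv n p) (by omega)]
    simp [Polynomial.hasseDeriv_coeff]
  · rw [Polynomial.coeff_sub, Polynomial.taylor_coeff]
    have hd := Polynomial.natDegree_hasseDeriv_le p s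
    rw [Polynomial.eval_eq_sum_range' (n := 2) (by omega)]
    simp only [Polynomial.hasseDeriv_coeff, sum_range_succ, range_zero, sum_empty, zero_add,
      Nat.choose_self, Nat.cast_one, one_mul, pow_zero, mul_one, pow_one]
    rw [add_comm 1 s, Nat.choose_succ_self_right]
    push_cast
    ring

theorem natCast_zmod_ne_zero {Q m : ℕ} (hm : 0 < m) (hmQ : m < Q) : (m : ZMod Q) ≠ 0 := by
  rw [Ne, ZMod.natCast_eq_zero_iff]
  exact fun h => absurd (Nat.le_of_dvd hm h) (by omega)

theorem norm_stdAddChar {Q : ℕ} [NeZero Q] (y : ZMod Q) : ‖ZMod.stdAddChar y‖ = 1 := by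
  rw [ZMod.stdAddChar_apply]
  exact Circle.norm_coe _

theorem expect_prod_eq {α β : Type*} [Fintype α] [Fintype β] (f : α × β → ℂ) :
    𝔼 x, f x = 𝔼 a, 𝔼 b, f (a, b) := by
  rw [← univ_product_univ, expect_product]

/-- A function on `ZMod M × ZMod Q` of the form `c u * χ (p v)`, where `χ` is the standard character
and `p` has degree exactly `s < Q`, has small `U^s` norm. -/
theorem norm_gowersAverage_phase_le {U : Type*} [AddCommGroup U] [Fintype U] {Q : ℕ}
    [Fact Q.Prime] {s : ℕ} (hs : 1 ≤ s) (hsQ : s < Q) (p : Polynomial (ZMod Q))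
    (hp : p.natDegree ≤ s) (hps : p.coeff s ≠ 0) (c : U → ℂ) {B : ℝ} (hc : ∀ u, ‖c u‖ ≤ B) :
    ‖gowersAverage s (fun x : U × ZMod Q => c x.1 * ZMod.stdAddChar (p.eval x.2))‖ ≤
      B ^ 2 ^ s * (s / Q) := by
  have hQ : 0 < (Q : ℝ) := by exact_mod_cast (Fact.out : Q.Prime).pos
  have hB : 0 ≤ B := (norm_nonneg _).trans (hc 0)
  induction s, hs using Nat.le_induction generalizing p c B with
  | base =>
    have h0 : 𝔼 x : U × ZMod Q, c x.1 * ZMod.stdAddChar (p.eval x.2) = 0 := by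
      rw [expect_prod_eq]
      refine expect_eq_zero fun u _ => ?_
      simp only
      rw [← mul_expect, Fintype.expect_eq_sum_div_card]
      have h1 : ∀ v : ZMod Q, (ZMod.stdAddChar (p.eval v) : ℂ) =
          ZMod.stdAddChar (p.coeff 0) * ZMod.stdAddChar (v * p.coeff 1) := by
        intro v
        rw [← AddChar.map_add_eq_mul, Polynomial.eval_eq_sum_range' (n := 2) (by omega)]
        simp [sum_range_succ, mul_comm]
      simp only [h1]
      rw [← mul_sum, AddChar.sum_mulShift _ (ZMod.isPrimitive_stdAddChar Q), if_neg hps]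
      simp
    rw [gowersAverage_one, h0]
    simp only [zero_mul, norm_zero]
    positivity
  | succ s hs ih =>
    rw [gowersAverage_succ, expect_prod_eq]
    refine norm_expect_le_of_le fun a => ?_
    refine (RCLike.norm_expect_le (K := ℂ)).trans ?_
    have hderiv : ∀ b : ZMod Q,
        mulDeriv (a, b) (fun x : U × ZMod Q => c x.1 * ZMod.stdAddChar (p.eval x.2)) =
          fun x => mulDeriv a c x.1 *
            ZMod.stdAddChar ((p - Polynomial.taylor (-b) p).eval x.2) := by
      intro b
      funext x
      simp only [mulDeriv, Prod.fst_sub, Prod.snd_sub, map_mul, Polynomial.eval_sub,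
        Polynomial.taylor_eval, ← sub_eq_add_neg]
      rw [sub_eq_add_neg (p.eval x.2), AddChar.map_add_eq_mul, AddChar.map_neg_eq_conj]
      ring
    have hcB : ∀ u, ‖mulDeriv a c u‖ ≤ B ^ 2 := fun u => by
      rw [mulDeriv, norm_mul, RCLike.norm_conj, sq]
      exact mul_le_mul (hc _) (hc _) (norm_nonneg _) hB
    have hpow : (B ^ 2) ^ 2 ^ s = B ^ 2 ^ (s + 1) := by rw [← pow_mul, pow_succ' 2 s]
    -- For `b ≠ 0` the derivative has leading coefficient `(s + 1) * p.coeff (s + 1) * b`, nonzero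
    -- since `s + 1 < Q`. The single shift `b = 0` is bounded trivially and adds `1 / Q`, turning `s
    -- / Q` into `(s + 1) / Q`.
    have hb : ∀ b : ZMod Q, ‖gowersAverage s
        (mulDeriv (a, b) (fun x : U × ZMod Q => c x.1 * ZMod.stdAddChar (p.eval x.2)))‖ ≤
        B ^ 2 ^ (s + 1) * (s / Q) + if b = 0 then B ^ 2 ^ (s + 1) else 0 := by
      intro b
      split_ifs with h0
      · rw [hderiv, ← hpow]
        refine (norm_gowersAverage_le (B := B ^ 2) fun x => ?_).trans ?_
        · rw [norm_mul, norm_stdAddChar, mul_one]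
          exact hcB _
        · have : 0 ≤ (B ^ 2) ^ 2 ^ s * ((s : ℝ) / Q) := by positivity
          linarith
      · rw [hderiv, add_zero, ← hpow]
        obtain ⟨h1, h2⟩ := natDegree_sub_taylor_le p hp b
        refine ih (by omega) _ h1 ?_ _ hcB (by positivity)
        rw [h2]
        refine mul_ne_zero (mul_ne_zero ?_ hps) h0
        have := natCast_zmod_ne_zero (m := s + 1) (by omega) hsQ
        exact_mod_cast this
    refine (expect_le_expect fun b _ => hb b).trans_eq ?_
    rw [expect_add_distrib, Fintype.expect_const, Fintype.expect_ite_eq']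
    rw [ZMod.card, NNRat.smul_def]
    push_cast
    field_simp

/-! ### Fourier coefficients of intervals -/

/-- The norm is `2 * |sin (π t)|` with `t = m / Q`, and Jordan's inequality applies on either half.
The form `t * (1 - t)` is convenient because its inverse splits into partial fractions. -/
theorem le_norm_stdAddChar_sub_one {Q : ℕ} [NeZero Q] {m : ℕ} (hmQ : m < Q) :
    4 * ((m : ℝ) / Q) * (1 - m / Q) ≤ ‖ZMod.stdAddChar (m : ZMod Q) - 1‖ := by
  have hQ : 0 < (Q : ℝ) := by exact_mod_cast NeZero.pos Q
  set t : ℝ := m / Q with ht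
  have ht0 : 0 ≤ t := by positivity
  have ht1 : t ≤ 1 := by
    rw [ht, div_le_one hQ]
    exact_mod_cast hmQ.le
  have h1 : (ZMod.stdAddChar (m : ZMod Q) : ℂ) = Complex.exp (Complex.I * ((2 * Real.pi * t : ℝ) : ℂ)) := by
    have := ZMod.stdAddChar_coe (N := Q) (m : ℤ)
    push_cast at this
    rw [this, ht]
    congr 1
    push_cast
    ring
  rw [h1, Complex.norm_exp_I_mul_ofReal_sub_one]
  have h2 : 2 * Real.pi * t / 2 = Real.pi * t := by ring
  rw [h2, Real.norm_eq_abs]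
  have hsin : 2 * t * (1 - t) ≤ Real.sin (Real.pi * t) := by
    rcases le_total t (1 / 2) with h | h
    · have := Real.mul_le_sin (x := Real.pi * t) (by positivity)
        (by nlinarith [Real.pi_pos])
      have e : 2 / Real.pi * (Real.pi * t) = 2 * t := by field_simp
      rw [e] at this
      nlinarith
    · have := Real.mul_le_sin (x := Real.pi * (1 - t))
        (mul_nonneg Real.pi_pos.le (by linarith)) (by nlinarith [Real.pi_pos])
      have e : 2 / Real.pi * (Real.pi * (1 - t)) = 2 * (1 - t) := by field_simp
      have e2 : Real.pi * (1 - t) = Real.pi - Real.pi * t := by ring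
      rw [e, e2, Real.sin_pi_sub] at this
      nlinarith
  refine le_trans ?_ (le_abs_self _)
  linarith

/-- The Fourier coefficient at `ξ` of the interval of length `L` starting at `θ` in `ZMod Q`. -/
noncomputable def intervalCoeff (Q L : ℕ) [NeZero Q] (θ ξ : ZMod Q) : ℂ :=
  (Q : ℂ)⁻¹ * ∑ x ∈ range L, ZMod.stdAddChar (-(ξ * (θ + ((x : ℕ) : ZMod Q))))

/-- A geometric series. The bound does not depend on `θ`, so the interval may move with the first
coordinate. -/
theorem norm_intervalCoeff_le {Q : ℕ} [NeZero Q] (L : ℕ) (θ : ZMod Q) {m : ℕ} (hm : 0 < m)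
    (hmQ : m < Q) : ‖intervalCoeff Q L θ m‖ ≤ ((m : ℝ)⁻¹ + ((Q - m : ℕ) : ℝ)⁻¹) / 2 := by
  have hQ : 0 < (Q : ℝ) := by exact_mod_cast NeZero.pos Q
  have hm' : 0 < (m : ℝ) := by exact_mod_cast hm
  have hQm : 0 < (Q : ℝ) - m := by
    have : (m : ℝ) < Q := by exact_mod_cast hmQ
    linarith
  set z : ℂ := ZMod.stdAddChar (-(m : ZMod Q)) with hz
  have hzm : z = starRingEnd ℂ (ZMod.stdAddChar (m : ZMod Q)) := by
    rw [hz, AddChar.map_neg_eq_conj]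
  have hz1 : ‖z - 1‖ = ‖ZMod.stdAddChar (m : ZMod Q) - 1‖ := by
    rw [hzm, ← RCLike.norm_conj (ZMod.stdAddChar (m : ZMod Q) - 1)]
    simp
  have hlow := le_norm_stdAddChar_sub_one hmQ
  rw [← hz1] at hlow
  have hpos : 0 < 4 * ((m : ℝ) / Q) * (1 - m / Q) := by
    have : (m : ℝ) / Q < 1 := by rw [div_lt_one hQ]; linarith
    have : 0 < 1 - (m : ℝ) / Q := by linarith
    positivity
  have hz0 : z ≠ 1 := by
    intro h
    rw [h, sub_self, norm_zero] at hlow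
    linarith
  have hsum : ∑ x ∈ range L, (ZMod.stdAddChar (-((m : ZMod Q) * (θ + ((x : ℕ) : ZMod Q)))) : ℂ) =
      ZMod.stdAddChar (-((m : ZMod Q) * θ)) * ((z ^ L - 1) / (z - 1)) := by
    rw [← geom_sum_eq hz0, mul_sum]
    refine sum_congr rfl fun x _ => ?_
    rw [hz, ← AddChar.map_nsmul_eq_pow, ← AddChar.map_add_eq_mul]
    congr 1
    rw [nsmul_eq_mul]
    ring
  have hzn : ‖z‖ = 1 := norm_stdAddChar _
  have hnum : ‖z ^ L - 1‖ ≤ 2 := by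
    refine (norm_sub_le _ _).trans ?_
    rw [norm_pow, hzn]
    norm_num
  unfold intervalCoeff
  rw [hsum, norm_mul, norm_mul, norm_stdAddChar, norm_div, one_mul, norm_inv, Complex.norm_natCast]
  calc (Q : ℝ)⁻¹ * (‖z ^ L - 1‖ / ‖z - 1‖)
      ≤ (Q : ℝ)⁻¹ * (2 / (4 * ((m : ℝ) / Q) * (1 - m / Q))) := by gcongr
    _ = ((m : ℝ)⁻¹ + ((Q - m : ℕ) : ℝ)⁻¹) / 2 := by
        rw [Nat.cast_sub hmQ.le]
        field_simp
        ring

/-- Fourier inversion; `L ≤ Q` ensures that no point of the interval is counted twice. -/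
theorem sum_intervalCoeff_mul {Q : ℕ} [NeZero Q] {L : ℕ} (hL : L ≤ Q) (θ y : ZMod Q) :
    ∑ ξ, intervalCoeff Q L θ ξ * ZMod.stdAddChar (ξ * y) =
      {y : ZMod Q | ∃ x < L, y = θ + (x : ℕ)}.indicator (fun _ => (1 : ℂ)) y := by
  have hQ : (Q : ℂ) ≠ 0 := by exact_mod_cast NeZero.ne Q
  have h1 : ∀ ξ : ZMod Q, intervalCoeff Q L θ ξ * ZMod.stdAddChar (ξ * y) =
      (Q : ℂ)⁻¹ * ∑ x ∈ range L, ZMod.stdAddChar (ξ * (y - (θ + ((x : ℕ) : ZMod Q)))) := by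
    intro ξ
    rw [intervalCoeff, mul_assoc, sum_mul]
    congr 1
    refine sum_congr rfl fun x _ => ?_
    rw [← AddChar.map_add_eq_mul]
    congr 1
    ring
  simp only [h1]
  rw [← mul_sum, sum_comm]
  simp only [AddChar.sum_mulShift _ (ZMod.isPrimitive_stdAddChar Q), ZMod.card]
  by_cases hy : ∃ x < L, y = θ + (x : ℕ)
  · rw [Set.indicator_of_mem (by exact hy)]
    obtain ⟨x, hx, rfl⟩ := hy
    rw [sum_eq_single_of_mem x (mem_range.2 hx)]
    · simp [hQ]
    · intro x' hx' hne
      rw [if_neg]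
      · simp
      intro h
      have h2 : ((x : ℕ) : ZMod Q) = x' := by linear_combination h
      rw [ZMod.natCast_eq_natCast_iff] at h2
      exact hne (Nat.ModEq.eq_of_lt_of_lt h2 (by omega) (by have := mem_range.1 hx'; omega)).symm
  · rw [Set.indicator_of_notMem (by exact hy), sum_eq_zero, mul_zero]
    intro x hx
    rw [if_neg]
    · simp
    · exact fun h => hy ⟨x, mem_range.1 hx, sub_eq_zero.1 h⟩

theorem sum_range_inv_add_inv_le (Q : ℕ) :
    ∑ m ∈ range (Q - 1), ((((m + 1 : ℕ) : ℝ)⁻¹ + ((Q - (m + 1) : ℕ) : ℝ)⁻¹) / 2) ≤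
      1 + Real.log Q := by
  have h1 : ∑ m ∈ range (Q - 1), ((Q - (m + 1) : ℕ) : ℝ)⁻¹ =
      ∑ m ∈ range (Q - 1), ((m + 1 : ℕ) : ℝ)⁻¹ := by
    rw [← sum_range_reflect]
    refine sum_congr rfl fun m hm => ?_
    have := mem_range.1 hm
    congr 2
    omega
  have h2 : ∑ m ∈ range (Q - 1), ((m + 1 : ℕ) : ℝ)⁻¹ ≤ 1 + Real.log Q := by
    have h3 := harmonic_le_one_add_log Q
    refine le_trans ?_ h3
    simp only [harmonic, Rat.cast_sum, Rat.cast_inv, Rat.cast_natCast]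
    exact sum_le_sum_of_subset_of_nonneg (range_mono (by omega)) fun _ _ _ => by positivity
  rw [← sum_div, sum_add_distrib, h1]
  linarith

/-! ### Uniformity of polynomial level sets -/

theorem sum_zmod_eq_sum_range {Q : ℕ} [NeZero Q] (F : ZMod Q → ℝ) :
    ∑ ξ, F ξ = ∑ m ∈ range Q, F (m : ZMod Q) := by
  refine sum_nbij' (fun ξ => ξ.val) (fun m => (m : ZMod Q)) ?_ ?_ ?_ ?_ ?_
  · exact fun ξ _ => mem_range.2 (ZMod.val_lt ξ)
  · exact fun _ _ => mem_univ _
  · exact fun ξ _ => ZMod.natCast_zmod_val ξ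
  · exact fun m hm => ZMod.val_cast_of_lt (mem_range.1 hm)
  · intro ξ _
    simp only [ZMod.natCast_zmod_val]

/-- The set of `(u, v)` such that `v ^ s` lies in the interval of length `L` starting at `θ u`. -/
def powLevelSet {U : Type*} {Q : ℕ} (s L : ℕ) (θ : U → ZMod Q) : Set (U × ZMod Q) :=
  {x | ∃ t < L, x.2 ^ s = θ x.1 + (t : ℕ)}

/-- One factor of the Gowers average is expanded in Fourier series. The zero frequency contributes
the density error `1 / Q`; each other frequency contributes its coefficient bound times the `U^s`
norm bound of a degree-`s` phase, and the coefficient bounds sum to at most `1 + log Q`. -/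
theorem norm_gowersAverage_powLevelSet_le {U : Type*} [AddCommGroup U] [Fintype U] {Q : ℕ}
    [Fact Q.Prime] {s L : ℕ} (hs : 1 ≤ s) (hsQ : s < Q) (hL : L ≤ Q) (θ : U → ZMod Q) {α : ℝ}
    (hα0 : 0 ≤ α) (hα1 : α ≤ 1) (hLα : |(L : ℝ) / Q - α| ≤ 1 / Q) :
    ‖gowersAverage s (fun x => (powLevelSet s L θ).indicator (fun _ => (1 : ℂ)) x - (α : ℂ))‖ ≤
      1 / Q + (1 + Real.log Q) * ((s : ℝ) / Q) ^ ((1 : ℝ) / 2 ^ s) := by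
  have hQ : 0 < (Q : ℝ) := by exact_mod_cast (Fact.out : Q.Prime).pos
  set f : U × ZMod Q → ℂ :=
    fun x => (powLevelSet s L θ).indicator (fun _ => (1 : ℂ)) x - (α : ℂ) with hf
  set g : ZMod Q → U × ZMod Q → ℂ := fun ξ x =>
    intervalCoeff Q L (θ x.1) ξ * ZMod.stdAddChar (ξ * x.2 ^ s) - if ξ = 0 then (α : ℂ) else 0
    with hg
  have hfg : f = fun x => ∑ ξ, g ξ x := by
    funext x
    simp only [hg, sum_sub_distrib, sum_intervalCoeff_mul hL, sum_ite_eq', mem_univ, if_true]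
    rfl
  have hf1 : ∀ x, ‖f x‖ ≤ 1 := by
    intro x
    by_cases hx : x ∈ powLevelSet s L θ
    · have : f x = ((1 - α : ℝ) : ℂ) := by
        simp only [hf, Set.indicator_of_mem hx]
        push_cast
        rfl
      rw [this, Complex.norm_real, Real.norm_of_nonneg (by linarith)]
      linarith
    · have : f x = ((-α : ℝ) : ℂ) := by
        simp only [hf, Set.indicator_of_notMem hx]
        push_cast
        ring
      rw [this, Complex.norm_real, norm_neg, Real.norm_of_nonneg hα0]
      exact hα1
  set δ : ℝ := ((s : ℝ) / Q) ^ ((1 : ℝ) / 2 ^ s) with hδ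
  have hδ0 : 0 ≤ δ := by positivity
  have hδp : δ ^ 2 ^ s = (s : ℝ) / Q := by
    rw [hδ, ← Real.rpow_natCast, ← Real.rpow_mul (by positivity)]
    simp
  have hzero : ‖cornerAverage s (g ((0 : ℕ) : ZMod Q)) f‖ ≤ 1 / Q := by
    refine norm_cornerAverage_le (fun x => ?_) hf1
    have : g ((0 : ℕ) : ZMod Q) x = (((L : ℝ) / Q - α : ℝ) : ℂ) := by
      simp [hg, intervalCoeff, div_eq_inv_mul]
    rw [this, Complex.norm_real]
    exact hLα
  have hpos : ∀ m ∈ range (Q - 1), ‖cornerAverage s (g ((m + 1 : ℕ) : ZMod Q)) f‖ ≤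
      ((((m + 1 : ℕ) : ℝ)⁻¹ + ((Q - (m + 1) : ℕ) : ℝ)⁻¹) / 2) * δ := by
    intro m hm
    have hmQ : m + 1 < Q := by have := mem_range.1 hm; omega
    have hm0 : ((m + 1 : ℕ) : ZMod Q) ≠ 0 := natCast_zmod_ne_zero (by omega) hmQ
    set B : ℝ := (((m + 1 : ℕ) : ℝ)⁻¹ + ((Q - (m + 1) : ℕ) : ℝ)⁻¹) / 2 with hB
    have hB0 : 0 ≤ B := by positivity
    set p : Polynomial (ZMod Q) := Polynomial.C ((m + 1 : ℕ) : ZMod Q) * Polynomial.X ^ s with hp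
    have hgp : g ((m + 1 : ℕ) : ZMod Q) = fun x : U × ZMod Q =>
        intervalCoeff Q L (θ x.1) ((m + 1 : ℕ) : ZMod Q) * ZMod.stdAddChar (p.eval x.2) := by
      funext x
      simp only [hg, if_neg hm0, sub_zero, hp, Polynomial.eval_mul, Polynomial.eval_C,
        Polynomial.eval_pow, Polynomial.eval_X]
    have h1 := norm_gowersAverage_phase_le hs hsQ p (Polynomial.natDegree_C_mul_X_pow_le _ _)
      (by rw [hp, Polynomial.coeff_C_mul_X_pow, if_pos rfl]; exact hm0)
      (fun u => intervalCoeff Q L (θ u) ((m + 1 : ℕ) : ZMod Q))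
      (fun u => norm_intervalCoeff_le L (θ u) (by omega) hmQ)
    have h2 := norm_cornerAverage_pow_le (g := g ((m + 1 : ℕ) : ZMod Q)) hs hf1
    rw [hgp] at h2 ⊢
    have h3 := h2.trans h1
    rw [← hδp, ← mul_pow] at h3
    exact le_of_pow_le_pow_left₀ (by positivity) (by positivity) h3
  calc ‖gowersAverage s f‖ = ‖cornerAverage s f f‖ := by rw [cornerAverage_self]
    _ = ‖cornerAverage s (fun x => ∑ ξ, g ξ x) f‖ := by rw [← hfg]
    _ = ‖∑ ξ, cornerAverage s (g ξ) f‖ := by rw [cornerAverage_sum]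
    _ ≤ ∑ ξ, ‖cornerAverage s (g ξ) f‖ := norm_sum_le _ _
    _ = ∑ m ∈ range Q, ‖cornerAverage s (g (m : ZMod Q)) f‖ :=
        sum_zmod_eq_sum_range fun ξ => ‖cornerAverage s (g ξ) f‖
    _ = ∑ m ∈ range (Q - 1), ‖cornerAverage s (g ((m + 1 : ℕ) : ZMod Q)) f‖ +
          ‖cornerAverage s (g ((0 : ℕ) : ZMod Q)) f‖ := by
        rw [← sum_range_succ' (fun m : ℕ => ‖cornerAverage s (g (m : ZMod Q)) f‖),
          Nat.sub_add_cancel (Fact.out : Q.Prime).one_le]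
    _ ≤ (1 + Real.log Q) * δ + 1 / Q := by
        refine add_le_add ((sum_le_sum hpos).trans ?_) hzero
        rw [← sum_mul]
        exact mul_le_mul_of_nonneg_right (sum_range_inv_add_inv_le Q) hδ0
    _ = _ := add_comm _ _

theorem tendsto_uniformity_bound (s : ℕ) :
    Filter.Tendsto (fun Q : ℕ => 1 / (Q : ℝ) +
      (1 + Real.log Q) * ((s : ℝ) / Q) ^ ((1 : ℝ) / 2 ^ s)) Filter.atTop (nhds 0) := by
  set a : ℝ := (1 : ℝ) / 2 ^ s with ha
  have ha0 : 0 < a := by positivity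
  have h1 : Filter.Tendsto (fun x : ℝ => 1 / x + ((s : ℝ) ^ a * (x ^ a)⁻¹ +
      (s : ℝ) ^ a * (Real.log x / x ^ a))) Filter.atTop (nhds 0) := by
    have hlog : Filter.Tendsto (fun x : ℝ => Real.log x / x ^ a) Filter.atTop (nhds 0) :=
      (isLittleO_log_rpow_atTop ha0).tendsto_div_nhds_zero
    have hpow : Filter.Tendsto (fun x : ℝ => (x ^ a)⁻¹) Filter.atTop (nhds 0) :=
      (tendsto_rpow_atTop ha0).inv_tendsto_atTop
    have hinv : Filter.Tendsto (fun x : ℝ => 1 / x) Filter.atTop (nhds 0) := by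
      simpa using tendsto_inv_atTop_zero (𝕜 := ℝ)
    simpa using hinv.add ((hpow.const_mul ((s : ℝ) ^ a)).add (hlog.const_mul ((s : ℝ) ^ a)))
  refine (h1.comp tendsto_natCast_atTop_atTop).congr fun Q => ?_
  simp only [Function.comp]
  rw [Real.div_rpow (by positivity) (by positivity)]
  ring

/-! ### Progressions in polynomial level sets -/

/-- Up to sign this is the `(k - 1)`-st finite difference of a polynomial of degree at most `s < k -
1`. -/
theorem sum_apCoeff_mul_pow {R : Type*} [CommRing R] {k s : ℕ} (hsk : s + 1 < k) (v w : R) :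
    ∑ i ∈ range k, (apCoeff k i : R) * (v + i • w) ^ s = 0 := by
  set P : Polynomial R := (Polynomial.C w * Polynomial.X + Polynomial.C v) ^ s with hP
  have hdeg : P.natDegree < k - 1 := by
    refine (Polynomial.natDegree_pow_le_of_le s Polynomial.natDegree_linear_le).trans_lt ?_
    omega
  have h1 := congrFun (Polynomial.fwdDiff_iter_eq_zero_of_degree_lt hdeg) 0
  rw [fwdDiff_iter_eq_sum_shift, Nat.sub_add_cancel (by omega : 1 ≤ k)] at h1
  have h2 : ∑ i ∈ range k, (apCoeff k i : R) * (v + i • w) ^ s =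
      (-1) ^ (k - 1) * ∑ i ∈ range k,
        ((-1 : ℤ) ^ (k - 1 - i) * (k - 1).choose i) • P.eval (0 + i • (1 : R)) := by
    rw [mul_sum]
    refine sum_congr rfl fun i hi => ?_
    have hi' := mem_range.1 hi
    have e : ((-1 : R)) ^ (k - 1) * (-1) ^ (k - 1 - i) = (-1) ^ i := by
      rw [← pow_add, show k - 1 + (k - 1 - i) = 2 * (k - 1 - i) + i by omega, pow_add, pow_mul]
      simp
    simp only [zsmul_eq_mul, apCoeff, hP, Polynomial.eval_pow, Polynomial.eval_add,
      Polynomial.eval_mul, Polynomial.eval_C, Polynomial.eval_X, nsmul_eq_mul, mul_one, zero_add]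
    push_cast
    rw [← e]
    ring
  rw [h2, h1]
  simp

/-- If the intervals are placed according to the moment code of a coloring, then progressions in
the level set have balanced colors. -/
theorem isBalanced_of_forall_mem_powLevelSet {U : Type*} [AddCommGroup U] {Q : ℕ}
    {k s L R H : ℕ} (hsk : s + 1 < k) (hL : 0 < L) (ψ : U → Fin R)
    (hH : ∀ a < R, momentCode k R a ≤ H) (hH0 : 0 < H) (hQ : 4 ^ k * L * H ≤ Q) {x d : U × ZMod Q}
    (hx : ∀ i < k, x + i • d ∈ powLevelSet s L
      (fun u => ((2 ^ (k - 1) * L * momentCode k R (ψ u) : ℕ) : ZMod Q))) :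
    IsBalanced k (fun i => ψ (x.1 + i • d.1)) := by
  have hk : 1 ≤ k := by omega
  choose! t htL ht using hx
  set a : ℕ → ℕ := fun i => ψ (x.1 + i • d.1) with ha
  have haR : ∀ i < k, a i < R := fun i _ => (ψ _).2
  set W : ℤ := 2 ^ (k - 1) * L with hW
  have hW0 : 0 < W := by positivity
  set Z : ℤ := ∑ i ∈ range k, apCoeff k i * (momentCode k R (a i) : ℤ) with hZ
  set Y : ℤ := ∑ i ∈ range k, apCoeff k i * (t i : ℤ) with hY
  -- Here `W * Z` comes from the interval positions and `Y` from the offsets inside the intervals.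
  have hdvd : (Q : ℤ) ∣ W * Z + Y := by
    rw [← ZMod.intCast_zmod_eq_zero_iff_dvd, ← sum_apCoeff_mul_pow hsk x.2 d.2, hW, hZ, hY,
      mul_sum, ← sum_add_distrib]
    push_cast
    refine sum_congr rfl fun i hi => ?_
    have := ht i (mem_range.1 hi)
    simp only [Prod.snd_add, Prod.smul_snd, Prod.fst_add, Prod.smul_fst] at this
    rw [this]
    push_cast
    ring
  have hYW : |Y| < W := by
    refine (abs_sum_apCoeff_mul_le hk (B := (L : ℤ) - 1) fun i hi => ?_).trans_lt ?_
    · have := htL i hi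
      rw [Nat.abs_cast]
      omega
    · rw [hW]
      exact mul_lt_mul_of_pos_left (by omega) (by positivity)
  have hZH : |Z| ≤ 2 ^ (k - 1) * H := by
    refine abs_sum_apCoeff_mul_le hk fun i hi => ?_
    rw [Nat.abs_cast]
    exact_mod_cast hH _ (haR i hi)
  have h4 : (2 : ℤ) ^ (k - 1) * (2 ^ (k - 1) * H + 1) ≤ 4 ^ k * H := by
    obtain ⟨l, rfl⟩ : ∃ l, k = l + 1 := ⟨k - 1, by omega⟩
    have e1 : (4 : ℤ) ^ (l + 1) = 4 * (2 ^ l * 2 ^ l) := by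
      rw [pow_succ, ← mul_pow]
      norm_num
      ring
    rw [Nat.add_sub_cancel, e1]
    have hone : (1 : ℤ) ≤ 2 ^ l := one_le_pow₀ (by norm_num)
    have hH1 : (1 : ℤ) ≤ H := by exact_mod_cast hH0
    have h5 : (2 : ℤ) ^ l * 1 ≤ 2 ^ l * (2 ^ l * H) :=
      mul_le_mul_of_nonneg_left (one_le_mul_of_one_le_of_one_le hone hH1) (by positivity)
    have h6 : (0 : ℤ) ≤ 2 ^ l * (2 ^ l * H) := by positivity
    linarith
  have hlt : |W * Z + Y| < Q := by
    calc |W * Z + Y| ≤ W * |Z| + |Y| := by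
          refine (abs_add_le _ _).trans_eq ?_
          rw [abs_mul, abs_of_pos hW0]
      _ < W * (2 ^ (k - 1) * H) + W := by
          have := mul_le_mul_of_nonneg_left hZH hW0.le
          linarith
      _ = L * (2 ^ (k - 1) * (2 ^ (k - 1) * H + 1)) := by rw [hW]; ring
      _ ≤ L * (4 ^ k * H) := mul_le_mul_of_nonneg_left h4 (by positivity)
      _ = ((4 ^ k * L * H : ℕ) : ℤ) := by push_cast; ring
      _ ≤ Q := by exact_mod_cast hQ
  have h0 := Int.eq_zero_of_abs_lt_dvd hdvd hlt
  -- The sum is too small to wrap around `Q`, so it is zero in the integers. The spacing `W` exceeds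
  -- any combination of offsets, so positions and offsets vanish separately.
  have hY0 : Y = 0 := Int.eq_zero_of_abs_lt_dvd ⟨-Z, by linarith⟩ hYW
  rw [hY0, add_zero] at h0
  have hZ0 : Z = 0 := (mul_eq_zero.1 h0).resolve_left hW0.ne'
  exact (isBalanced_of_sum_momentCode hk haR hZ0).of_comp (f := Fin.val) Fin.val_injective

theorem prod_indicator_le_one {G : Type*} [AddCommGroup G] (A : Set G) (k : ℕ) (n d : G) :
    ∏ i ∈ range k, A.indicator (fun _ => (1 : ℝ)) (n + i • d) ≤ 1 :=
  prod_le_one (fun _ _ => Set.indicator_nonneg (fun _ _ => zero_le_one) _)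
    fun _ _ => Set.indicator_le_self' (fun _ _ => zero_le_one) _

theorem apDensity_nonneg {G : Type*} [AddCommGroup G] [Fintype G] (k : ℕ) (A : Set G) :
    0 ≤ apDensity k A :=
  expect_nonneg fun _ _ => expect_nonneg fun _ _ => prod_nonneg fun _ _ =>
    Set.indicator_nonneg (fun _ _ => zero_le_one) _

/-- If every progression in `A` has trivial first component, the density of progressions is at most
the proportion of such differences. -/
theorem apDensity_le_inv_card {U V : Type*} [AddCommGroup U] [Fintype U] [AddCommGroup V]
    [Fintype V] {k : ℕ} {A : Set (U × V)}
    (hA : ∀ x d : U × V, (∀ i < k, x + i • d ∈ A) → d.1 = 0) :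
    apDensity k A ≤ 1 / Fintype.card U := by
  classical
  refine expect_le univ_nonempty fun n _ => ?_
  rw [← univ_product_univ, expect_product]
  have h1 : ∀ e : U, 𝔼 w : V, ∏ i ∈ range k, A.indicator (fun _ => (1 : ℝ)) (n + i • (e, w)) ≤
      if e = 0 then 1 else 0 := by
    intro e
    refine expect_le univ_nonempty fun w _ => ?_
    split_ifs with he
    · exact prod_indicator_le_one _ _ _ _
    · by_contra! hne
      refine he (hA n (e, w) fun i hi => ?_)
      by_contra hmem
      rw [prod_eq_zero (mem_range.2 hi) (Set.indicator_of_notMem hmem _)] at hne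
      exact lt_irrefl _ hne
  refine (expect_le_expect fun e _ => h1 e).trans_eq ?_
  rw [Fintype.expect_ite_eq', NNRat.smul_def]
  push_cast
  ring

/-! ### Uniform sets with few progressions -/

/-- A coloring of `ZMod M` without balanced progressions yields uniform sets whose density of
progressions is at most `1 / M`. -/
theorem exists_uniform_set {k M R : ℕ} (hk : 3 ≤ k) (hM : M.Prime) {ψ : ZMod M → Fin R}
    (hψ : ∀ u e : ZMod M, e ≠ 0 → ¬ IsBalanced k (fun i => ψ (u + i • e))) {α : ℝ} (hα0 : 0 < α)
    (hα1 : α ≤ 1)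
    (hαR : α * (4 ^ k * (k * (2 ^ (k * k) * (R : ℝ) ^ (k * k + k)))) ≤ 1) {η : ℝ} (hη : 0 < η)
    (N₀ : ℕ) : ∃ (N : ℕ) (_ : NeZero N), N₀ ≤ N ∧ ∃ A : Set (ZMod N),
      gowersNorm (k - 2) (fun n => A.indicator (fun _ => (1 : ℂ)) n - (α : ℂ)) ≤ η ∧
        apDensity k A ≤ 1 / M := by
  set s := k - 2 with hs
  obtain ⟨Q₀, hQ₀⟩ := Filter.eventually_atTop.1
    ((tendsto_uniformity_bound s).eventually (gt_mem_nhds (show 0 < η ^ 2 ^ s by positivity)))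
  -- The summands ensure, in order: the uniformity bound, `N₀ ≤ M * Q`, coprimality with `M`, degree
  -- below `Q`, and a nonempty interval.
  obtain ⟨Q, hQle, hQ⟩ := Nat.exists_infinite_primes (Q₀ + N₀ + M + k + ⌈1 / α⌉₊ + 1)
  have : Fact M.Prime := ⟨hM⟩
  have : Fact Q.Prime := ⟨hQ⟩
  have hQpos : 0 < (Q : ℝ) := by exact_mod_cast hQ.pos
  have hαQ : 1 ≤ α * Q := by
    have h1 : 1 / α ≤ Q := (Nat.le_ceil _).trans (by exact_mod_cast (by omega : ⌈1 / α⌉₊ ≤ Q))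
    rwa [div_le_iff₀ hα0, mul_comm] at h1
  set L : ℕ := ⌊α * Q⌋₊ with hL
  have hL0 : 0 < L := Nat.floor_pos.2 hαQ
  have hLle : (L : ℝ) ≤ α * Q := Nat.floor_le (by positivity)
  have hLlt : α * Q < L + 1 := Nat.lt_floor_add_one _
  have hLQ : L ≤ Q := by
    have : (L : ℝ) ≤ Q := hLle.trans (mul_le_of_le_one_left hQpos.le hα1)
    exact_mod_cast this
  have hLα : |(L : ℝ) / Q - α| ≤ 1 / Q := by
    have e : (L : ℝ) / Q - α = (L - α * Q) / Q := by field_simp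
    rw [e, abs_div, abs_of_pos hQpos]
    refine div_le_div_of_nonneg_right ?_ hQpos.le
    rw [abs_le]
    constructor <;> linarith
  have hR : 0 < R := (Nat.zero_le _).trans_lt (ψ 0).2
  set H : ℕ := k * (2 ^ (k * k) * R ^ (k * k + k)) with hH
  have hH0 : 0 < H := by positivity
  have hHQ : 4 ^ k * L * H ≤ Q := by
    have : ((4 : ℝ) ^ k * L * H) ≤ Q := by
      calc (4 : ℝ) ^ k * L * H ≤ 4 ^ k * (α * Q) * H := by gcongr
        _ = α * (4 ^ k * (k * (2 ^ (k * k) * (R : ℝ) ^ (k * k + k)))) * Q := by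
            rw [hH]; push_cast; ring
        _ ≤ 1 * Q := mul_le_mul_of_nonneg_right hαR hQpos.le
        _ = Q := one_mul _
    exact_mod_cast this
  set θ : ZMod M → ZMod Q := fun u => ((2 ^ (k - 1) * L * momentCode k R (ψ u) : ℕ) : ZMod Q)
    with hθ
  have hcop : M.Coprime Q := (Nat.coprime_primes hM hQ).2 (by omega)
  let e : ZMod (M * Q) ≃+ ZMod M × ZMod Q := (ZMod.chineseRemainder hcop).toAddEquiv
  have hN : NeZero (M * Q) := ⟨mul_ne_zero hM.ne_zero hQ.ne_zero⟩
  refine ⟨M * Q, hN, ?_, e ⁻¹' powLevelSet s L θ, ?_, ?_⟩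
  · have : Q ≤ M * Q := Nat.le_mul_of_pos_left _ hM.pos
    omega
  · have h1 := gowersNorm_comp_addEquiv e s
      (fun x => (powLevelSet s L θ).indicator (fun _ => (1 : ℂ)) x - (α : ℂ))
    have h2 : (fun n => (e ⁻¹' powLevelSet s L θ).indicator (fun _ => (1 : ℂ)) n - (α : ℂ)) =
        fun m => (powLevelSet s L θ).indicator (fun _ => (1 : ℂ)) (e m) - (α : ℂ) := by
      funext m
      congr 1
    rw [h2, h1]
    refine gowersNorm_le_of_norm_gowersAverage_le hη.le
      ((norm_gowersAverage_powLevelSet_le (by omega) (by omega) hLQ θ hα0.le hα1 hLα).trans ?_)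
    exact (hQ₀ Q (by omega)).le
  · rw [apDensity_preimage_addEquiv]
    have h1 := apDensity_le_inv_card (k := k) (A := powLevelSet s L θ) fun x d hxd => by
      by_contra hd
      exact hψ x.1 d.1 hd (isBalanced_of_forall_mem_powLevelSet (by omega) hL0 ψ
        (fun a ha => momentCode_le ha) hH0 hHQ hxd)
    rwa [ZMod.card] at h1

/-- The choice of the modulus: for small `α` there is a prime `M > α ^ (-C)` such that `ZMod M` has
a suitable coloring. -/
theorem exists_prime_coloring {k : ℕ} (hk : 2 ≤ k) (hke : Even k)
    (hcol : ∃ g : ℕ → ℝ, Filter.Tendsto g Filter.atTop (nhds 0) ∧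
      ∀ N : ℕ, 1 ≤ N → ∃ r : ℕ, (r : ℝ) ≤ (N : ℝ) ^ g N ∧
        ∃ φ : ℤ → Fin r, ¬ HasSymmetricallyColoredAP k N φ) {C : ℝ} (hC : 0 < C) :
    ∃ α₀ : ℝ, 0 < α₀ ∧ α₀ ≤ 1 ∧ ∀ α : ℝ, 0 < α → α < α₀ →
      ∃ M R : ℕ, M.Prime ∧ 1 / (M : ℝ) < α ^ C ∧
        α * (4 ^ k * (k * (2 ^ (k * k) * (R : ℝ) ^ (k * k + k)))) ≤ 1 ∧
        ∃ ψ : ZMod M → Fin R, ∀ u e : ZMod M, e ≠ 0 → ¬ IsBalanced k (fun i => ψ (u + i • e)) := by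
  set m : ℕ := k * k + k with hm
  have hm0 : (0 : ℝ) < m := by
    have : 0 < m := by omega
    exact_mod_cast this
  -- With `C' ≥ 1` the modulus exceeds `α⁻¹`, hence also `M₀`. The choice of `ε` below makes `R ^ m`
  -- at most a constant times `α⁻¹ ^ (1 / 2)`.
  set C' : ℝ := C + 1 with hC'
  have hC'1 : 1 ≤ C' := by linarith
  set ε : ℝ := 1 / (2 * m * C') with hε
  have hε0 : 0 < ε := by positivity
  obtain ⟨M₀, hM₀⟩ := exists_zmod_coloring hk hke hcol hε0
  set K : ℝ := 4 ^ k * (k * (2 ^ (k * k) * 4)) with hK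
  have hk0 : (0 : ℝ) < k := by exact_mod_cast (by omega : 0 < k)
  have hK1 : 0 < K := by positivity
  -- The bound `1 / K ^ 2` lets the remaining factor `sqrt α` absorb `K`. The `4` inside `K` comes
  -- from `M ≤ 4 * y`, that is, from Bertrand's postulate and rounding.
  refine ⟨min 1 (min (1 / (M₀ + 1)) (1 / K ^ 2)), by positivity, min_le_left _ _, ?_⟩
  intro α hα0 hα
  rw [lt_min_iff, lt_min_iff] at hα
  obtain ⟨hα1, hαM, hαK⟩ := hα
  set y : ℝ := α⁻¹ ^ C' with hy
  have hinv1 : 1 ≤ α⁻¹ := (one_le_inv₀ hα0).2 hα1.le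
  have hy1 : α⁻¹ ≤ y := by
    calc α⁻¹ = α⁻¹ ^ (1 : ℝ) := (Real.rpow_one _).symm
      _ ≤ y := Real.rpow_le_rpow_of_exponent_le hinv1 hC'1
  have hy0 : 0 < y := by positivity
  obtain ⟨M, hM, hXM, hMX⟩ := Nat.exists_prime_lt_and_le_two_mul ⌈y⌉₊ (Nat.ceil_pos.2 hy0).ne'
  have hyM : y < M := (Nat.le_ceil y).trans_lt (by exact_mod_cast hXM)
  have hM4 : (M : ℝ) ≤ 4 * y := by
    have h1 : (M : ℝ) ≤ 2 * ⌈y⌉₊ := by exact_mod_cast hMX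
    have h2 := Nat.ceil_lt_add_one hy0.le
    linarith
  have hMM₀ : M₀ ≤ M := by
    have h1 : (M₀ : ℝ) + 1 < α⁻¹ := by
      rw [lt_inv_comm₀ (by positivity) hα0]
      simpa using hαM
    have h2 : (M₀ : ℝ) ≤ M := by linarith
    exact_mod_cast h2
  obtain ⟨R, hR, ψ, hψ⟩ := hM₀ M hM hMM₀
  refine ⟨M, R, hM, ?_, ?_, ψ, hψ⟩
  · calc 1 / (M : ℝ) < 1 / y := one_div_lt_one_div_of_lt hy0 hyM
      _ = α ^ C' := by rw [hy, Real.inv_rpow hα0.le, one_div, inv_inv]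
      _ ≤ α ^ C := Real.rpow_le_rpow_of_exponent_ge hα0 hα1.le (by linarith)
  · have hRm : (R : ℝ) ^ m ≤ 4 * α⁻¹ ^ ((1 : ℝ) / 2) := by
      have hMpos : (0 : ℝ) < M := hy0.trans hyM
      have hexp : 1 / (2 * C') ≤ 1 := by
        rw [div_le_one (by positivity)]
        linarith
      calc (R : ℝ) ^ m ≤ ((M : ℝ) ^ ε) ^ m := pow_le_pow_left₀ (by positivity) hR m
        _ = (M : ℝ) ^ (1 / (2 * C')) := by
            rw [← Real.rpow_natCast, ← Real.rpow_mul hMpos.le, hε]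
            congr 1
            field_simp
        _ ≤ (4 * y) ^ (1 / (2 * C')) := Real.rpow_le_rpow hMpos.le hM4 (by positivity)
        _ = 4 ^ (1 / (2 * C')) * y ^ (1 / (2 * C')) := Real.mul_rpow (by norm_num) hy0.le
        _ ≤ 4 * α⁻¹ ^ ((1 : ℝ) / 2) := by
            refine mul_le_mul ?_ (le_of_eq ?_) (by positivity) (by norm_num)
            · calc (4 : ℝ) ^ (1 / (2 * C')) ≤ 4 ^ (1 : ℝ) :=
                    Real.rpow_le_rpow_of_exponent_le (by norm_num) hexp
                _ = 4 := Real.rpow_one _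
            · rw [hy, ← Real.rpow_mul (by positivity)]
              congr 1
              field_simp
    have hsq : K * Real.sqrt α ≤ 1 := by
      have h1 : Real.sqrt α ≤ 1 / K := by
        rw [Real.sqrt_le_left (by positivity), div_pow, one_pow]
        exact hαK.le
      calc K * Real.sqrt α ≤ K * (1 / K) := mul_le_mul_of_nonneg_left h1 hK1.le
        _ = 1 := by field_simp
    have hαs : α * α⁻¹ ^ ((1 : ℝ) / 2) = Real.sqrt α := by
      rw [← Real.sqrt_eq_rpow, Real.sqrt_inv, ← div_eq_mul_inv, Real.div_sqrt]
    calc α * (4 ^ k * (k * (2 ^ (k * k) * (R : ℝ) ^ m)))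
        ≤ α * (4 ^ k * (k * (2 ^ (k * k) * (4 * α⁻¹ ^ ((1 : ℝ) / 2))))) := by gcongr
      _ = K * (α * α⁻¹ ^ ((1 : ℝ) / 2)) := by rw [hK]; ring
      _ ≤ 1 := by rw [hαs]; exact hsq

/-! ### The largest lower bound -/

theorem zero_mem_apDensityBounds (k : ℕ) (α : ℝ) : 0 ∈ apDensityBounds k α :=
  fun ε hε => ⟨1, one_pos, 0, fun N _ _ A _ => by
    have := apDensity_nonneg k A
    linarith⟩

/-- The supremum is attained because the defining condition has an `ε` of slack, half of which pays
for approximating it. -/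
theorem isGreatest_rho {k : ℕ} {α : ℝ} (h : BddAbove (apDensityBounds k α)) :
    IsGreatest (apDensityBounds k α) (rho k α) := by
  refine ⟨fun ε hε => ?_, fun ρ hρ => le_csSup h hρ⟩
  obtain ⟨ρ, hρ, hlt⟩ := exists_lt_of_lt_csSup ⟨0, zero_mem_apDensityBounds k α⟩
    (show rho k α - ε / 2 < sSup (apDensityBounds k α) by unfold rho; linarith)
  obtain ⟨η, hη, N₀, hN₀⟩ := hρ (ε / 2) (by positivity)
  refine ⟨η, hη, N₀, fun N _ hN A hA => ?_⟩
  have := hN₀ N hN A hA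
  linarith

end UniformAP

theorem mainTheorem5 (k : ℕ) (hk : 4 ≤ k) (hk_even : Even k)
    (hcol : ∃ g : ℕ → ℝ, Filter.Tendsto g Filter.atTop (nhds 0) ∧
      ∀ N : ℕ, 1 ≤ N → ∃ r : ℕ, (r : ℝ) ≤ (N : ℝ) ^ g N ∧
        ∃ φ : ℤ → Fin r, ¬ UniformAP.HasSymmetricallyColoredAP k N φ) :
    ∀ C : ℝ, 0 < C → ∃ α₀ : ℝ, 0 < α₀ ∧ α₀ ≤ 1 ∧ ∀ α : ℝ, 0 < α → α < α₀ →
      IsGreatest (UniformAP.apDensityBounds k α) (UniformAP.rho k α) ∧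
        UniformAP.rho k α < α ^ C := by
  intro C hC
  obtain ⟨α₀, hα₀, hα₀1, h⟩ := UniformAP.exists_prime_coloring (by omega) hk_even hcol hC
  refine ⟨α₀, hα₀, hα₀1, fun α hα hαα₀ => ?_⟩
  obtain ⟨M, R, hM, hMα, hR, ψ, hψ⟩ := h α hα hαα₀
  -- `M` depends only on `α` and `C`, whereas the uniform set may be chosen after `η` and `N₀`;
  -- hence it tests every admissible `ρ`.
  have hbound : ∀ ρ ∈ UniformAP.apDensityBounds k α, ρ ≤ 1 / M := by
    intro ρ hρ
    refine le_of_forall_pos_le_add fun ε hε => ?_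
    obtain ⟨η, hη, N₀, hN₀⟩ := hρ ε hε
    obtain ⟨N, _, hN, A, hA, hAM⟩ :=
      UniformAP.exists_uniform_set (by omega) hM hψ hα (hαα₀.le.trans hα₀1) hR hη N₀
    have := hN₀ N hN A hA
    linarith
  have hgreatest := UniformAP.isGreatest_rho (k := k) (α := α) ⟨_, hbound⟩
  exact ⟨hgreatest, (hbound _ hgreatest.1).trans_lt hMα⟩
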